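/- Define $f_j\in\mathbb{Z}[u]$ for all $j\in\mathbb{Z}$ by $f_0=0$, $f_1=1$ and $f_{j+1}-uf_j+f_{j-1}=0$, and put $g_j=f_j-f_{j-1}$. For $k\in\mathbb{Z}$ define $\Phi_k$ by $\Phi_{2j}=f_j$ and $\Phi_{2j-1}=g_j$. For integers $k,l$ with $l$ even let $$F_{k,l}=\Phi_{k+1}(r)\Phi_{l-1}(t)-\Phi_{k-1}(r)\Phi_{l+1}(t)\in\mathbb{Q}[r,t],$$ and let $D(k,l)$ be the projective closure (scheme-theoretic closure) in $\mathbb{P}^1_{\mathbb{Q}}(r)\times\mathbb{P}^1_{\mathbb{Q}}(t)$ of the closed subscheme $F_{k,l}=0$ of the affine plane $\mathbb{A}^1(r)\times\mathbb{A}^1(t)$. For even $l\neq 0$ let $D_1(l,l)$ be the projective closure in $\mathbb{P}^1_{\mathbb{Q}}\times\mathbb{P}^1_{\mathbb{Q}}$ of the residual scheme of the line $r=t$ in the affine part of $D(l,l)$, i.e. of the closed subscheme of the affine plane defined by the ideal quotient $\big((F_{l,l}):(t-r)\big)$; equivalently, of the affine scheme $F_{l,l}/(t-r)=0$. **Theorem.**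 Let $l$ be an even integer with $|l|\geq 2$. 1. If $k$ is an integer with $k\neq l$ and $|k|\geq 2$, then $D(k,l)$ is a smooth curve over $\mathbb{Q}$ (smooth of relative dimension $1$ over $\operatorname{Spec}\mathbb{Q}$). 2. If $|l|>2$, then $D_1(l,l)$ is a smooth curve over $\mathbb{Q}$ (smooth of relative dimension $1$ over $\operatorname{Spec}\mathbb{Q}$). -/

import Mathlib

noncomputable section

namespace DoubleTwist

open AlgebraicGeometry CategoryTheory CategoryTheory.Limits Polynomial

/-! ### The polynomials `f_j`, `g_j`, `Φ_k` -/

/-- `f_j ∈ ℤ[u]` for `j ∈ ℤ`: `f_0 = 0`, `f_1 = 1`, `f_{j+1} - u f_j + f_{j-1} = 0`.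
These are rescaled Chebyshev polynomials of the second kind with the index shifted by one. -/
def f (j : ℤ) : ℤ[X] := Chebyshev.S ℤ (j - 1)

theorem f_zero : f 0 = 0 := by simp [f]

theorem f_one : f 1 = 1 := by simp [f]

theorem f_recurrence (j : ℤ) : f (j + 1) - X * f j + f (j - 1) = 0 := by
  have h := Chebyshev.S_add_one ℤ (j - 1)
  rw [sub_add_cancel] at h
  simp only [f, add_sub_cancel_right, h]
  ring

/-- `g_j = f_j - f_{j-1}`. -/
def g (j : ℤ) : ℤ[X] := f j - f (j - 1)

/-- `Φ_{2j} = f_j` and `Φ_{2j-1} = g_j`. -/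
def Phi (k : ℤ) : ℤ[X] := if Even k then f (k / 2) else g ((k + 1) / 2)

theorem Phi_even (j : ℤ) : Phi (2 * j) = f j := by
  simp [Phi]

theorem Phi_odd (j : ℤ) : Phi (2 * j - 1) = g j := by
  have h : ¬ Even (2 * j - 1) := by
    rw [Int.not_even_iff_odd]
    exact ⟨j - 1, by ring⟩
  simp [Phi, h]

/-! ### The affine equations, in `ℚ[r, t]` with `r = X 0` and `t = X 1` -/

/-- The coordinate ring `ℚ[r, t]` of the standard affine part `𝔸¹(r) × 𝔸¹(t)`. -/
abbrev PlaneRing : Type := MvPolynomial (Fin 2) ℚ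

/-- The first affine coordinate. -/
def r : PlaneRing := MvPolynomial.X 0

/-- The second affine coordinate. -/
def t : PlaneRing := MvPolynomial.X 1

/-- `Φ_{k+1}(r) Φ_{l-1}(t) - Φ_{k-1}(r) Φ_{l+1}(t)`. -/
def equation (k l : ℤ) : PlaneRing :=
  aeval r (Phi (k + 1)) * aeval t (Phi (l - 1)) - aeval r (Phi (k - 1)) * aeval t (Phi (l + 1))

/-! ### `ℙ¹ × ℙ¹` over `ℚ` -/

/-- The standard grading of `ℚ[X₀, X₁]` by degree. -/
abbrev grading : ℕ → Submodule ℚ (MvPolynomial (Fin 2) ℚ) :=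
  MvPolynomial.homogeneousSubmodule (Fin 2) ℚ

instance : GradedAlgebra grading := MvPolynomial.gradedAlgebra

/-- The projective line over `ℚ`. -/
abbrev P1 : Scheme.{0} := Proj grading

/-- The structure morphism of the projective line. -/
def P1.toSpec : P1 ⟶ Spec (.of ℚ) :=
  Proj.toSpecZero grading ≫ Spec.map (CommRingCat.ofHom (algebraMap ℚ (grading 0)))

/-- The product `ℙ¹ × ℙ¹` over `ℚ`. -/
abbrev P1xP1 : Scheme.{0} := pullback P1.toSpec P1.toSpec

/-- The structure morphism of `ℙ¹ × ℙ¹`. -/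
def P1xP1.toSpec : P1xP1 ⟶ Spec (.of ℚ) := pullback.fst P1.toSpec P1.toSpec ≫ P1.toSpec

/-- For `a` in a `ℚ`-algebra `R`, the ring homomorphism from the coordinate ring of the chart
`X₁ ≠ 0` of `ℙ¹` (the degree zero part of `ℚ[X₀, X₁][X₁⁻¹]`) to `R` that sends the affine
coordinate `X₀ / X₁` to `a`. -/
def chartHom {R : Type} [CommRing R] [Algebra ℚ R] (a : R) :
    HomogeneousLocalization.Away grading (MvPolynomial.X 1) →+* R :=
  (IsLocalization.Away.lift (S := Localization.Away (MvPolynomial.X 1 : MvPolynomial (Fin 2) ℚ))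
    (g := (MvPolynomial.aeval (R := ℚ) ![a, 1] : MvPolynomial (Fin 2) ℚ →ₐ[ℚ] R).toRingHom)
    (MvPolynomial.X 1) (by simp)).comp
  (algebraMap (HomogeneousLocalization.Away grading (MvPolynomial.X 1))
    (Localization.Away (MvPolynomial.X 1 : MvPolynomial (Fin 2) ℚ)))

/-- The morphism `Spec R ⟶ ℙ¹` with homogeneous coordinates `(a : 1)`. -/
def toP1 {R : Type} [CommRing R] [Algebra ℚ R] (a : R) : Spec (.of R) ⟶ P1 :=
  Spec.map (CommRingCat.ofHom (chartHom a)) ≫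
    Proj.awayι grading (MvPolynomial.X 1)
      ((MvPolynomial.mem_homogeneousSubmodule 1 _).2 (MvPolynomial.isHomogeneous_X ℚ 1)) one_pos

theorem toP1_toSpec {R : Type} [CommRing R] [Algebra ℚ R] (a : R) :
    toP1 a ≫ P1.toSpec = Spec.map (CommRingCat.ofHom (algebraMap ℚ R)) := by
  rw [toP1, P1.toSpec, Category.assoc, Proj.awayι_toSpecZero_assoc, ← Spec.map_comp,
    ← Spec.map_comp, ← CommRingCat.ofHom_comp, ← CommRingCat.ofHom_comp]
  congr 2
  exact Subsingleton.elim _ _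

/-- The inclusion of the standard affine part `𝔸¹(r) × 𝔸¹(t)` in `ℙ¹(r) × ℙ¹(t)`. -/
def affinePart : Spec (.of PlaneRing) ⟶ P1xP1 :=
  pullback.lift (toP1 r) (toP1 t) (by rw [toP1_toSpec, toP1_toSpec])

/-! ### Projective closures and the curves `D(k, l)`, `D₁(l, l)` -/

/-- The closed subscheme of the affine plane defined by `I`, mapped to `ℙ¹ × ℙ¹`. -/
def affineCurve (I : Ideal PlaneRing) : Spec (.of (PlaneRing ⧸ I)) ⟶ P1xP1 :=
  Spec.map (CommRingCat.ofHom (Ideal.Quotient.mk I)) ≫ affinePart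

/-- The projective closure in `ℙ¹ × ℙ¹` of the closed subscheme of the affine plane defined
by `I`, i.e. its scheme-theoretic closure. -/
abbrev closure (I : Ideal PlaneRing) : Scheme.{0} := (affineCurve I).image

/-- The structure morphism of the projective closure. -/
def closure.toSpec (I : Ideal PlaneRing) : closure I ⟶ Spec (.of ℚ) :=
  (affineCurve I).imageι ≫ P1xP1.toSpec

/-- The ideal of the affine part of `D(k, l)`. -/
def idealD (k l : ℤ) : Ideal PlaneRing := Ideal.span {equation k l}

/-- The ideal of the scheme-theoretic (residual) complement of the line `r = t` in the affine
part of `D(l, l)`: the ideal quotient `(F) : (t - r)`, where `F` is the equation of `D(l, l)`. -/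
def idealD₁ (l : ℤ) : Ideal PlaneRing := (idealD l l).colon {t - r}

/-- The curve `D(k, l)`. -/
abbrev D (k l : ℤ) : Scheme.{0} := closure (idealD k l)

/-- The structure morphism of `D(k, l)`. -/
def D.toSpec (k l : ℤ) : D k l ⟶ Spec (.of ℚ) := closure.toSpec (idealD k l)

/-- The curve `D₁(l, l)`. -/
abbrev D₁ (l : ℤ) : Scheme.{0} := closure (idealD₁ l)

/-- The structure morphism of `D₁(l, l)`. -/
def D₁.toSpec (l : ℤ) : D₁ l ⟶ Spec (.of ℚ) := closure.toSpec (idealD₁ l)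

end DoubleTwist

end

/-!
The curve `D(k, l)` is the closure of `h_k(r) = h_l(t)`, where `h_k = Φ_{k+1} / Φ_{k-1}`. Two
independent facts make it smooth.

*Geometry.* `ℙ¹ × ℙ¹` is covered by four affine planes, and on each of them the scheme-theoretic
closure is cut out by the kernel of a ring homomorphism from `ℚ[r, t]` to a localization of the
coordinate ring of the affine curve (`smoothOfRelativeDimension_image`). When the affine curve is
`G = 0`, this kernel is generated by `G` rewritten in the coordinates of the chart with the
denominators cleared, provided that the result is not divisible by an inverted coordinate
(`ker_changeCoord`). So smoothness is the statement that the four polynomials have no singular point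
over `ℚ̄` (`smooth_closure_of_not_isSing`). As the coordinate changes transport singular points,
only the affine plane and the points at infinity have to be examined.

*Arithmetic.* A singular point `(r, t)` of `h_k(r) = h_l(t)` is a pair of critical points of `h_k`
and `h_l` with a common critical value. The numerator of `h_k'` is the Wronskian `W_k` of `Φ_{k-1}`
and `Φ_{k+1}`. At infinity it does not vanish, because the degrees of `Φ_{k-1}` and `Φ_{k+1}` differ
by one (`wronskian_chartPhi_ne_zero`). On the affine line, `(X + 2) W_k = f_k + k` for even `k` and
`(X² - 4) W_k = f_k - k` for odd `k`, so that critical points are algebraic integers with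
`f_k(r) = ∓k`, and everything can be compared at a valuation `v` above `2`.

* If `k` is odd, reduction to the residue field of `v` makes `Φ_{l-1}` and `Φ_{l+1}` vanish at a
  common point, which never happens (`false_of_residue`).
* If `k = 2m` and `l = 2n` are even and different, both critical points satisfy a quadratic equation
  with the critical value `c`, namely `l (c² - t c + 1) = c² - 1` and likewise for `k`, `r`. Hence
  `r` and `t` are `2`-adically close. With `r = x + x⁻¹` and `t = y + y⁻¹`, the equations
  `x^k (c - x) = 1 - c x` and `y^l (c - y) = 1 - c y` turn this into an upper bound for
  `v (x^(k-l) - 1)`, which is incompatible with the exact value of `v (x^(2k) - 1)` given by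
  `f_k(r) = -k`; the comparison rests on the fact that squaring a unit that is congruent to `1`
  modulo more than `2` multiplies its distance to `1` by exactly `v 2` (`IsCritical.false_of_ne`).
* If `k = l`, the two quadratic equations give `r = t` (`IsCritical.eq`). A singular point of the
  residual curve is therefore on the diagonal, where it is a zero of `W_l` and of `W_l'`
  (`IsSing.aeval_derivative_wr`); but `W_l` is separable (`wr_separable`).
-/

noncomputable section

namespace DoubleTwist

open AlgebraicGeometry CategoryTheory CategoryTheory.Limits

/-! ### Smoothness of scheme-theoretic images, chart by chart -/

section

/-- The formation of the kernel of a quasi-compact morphism commutes with restriction to an open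
subscheme of the target. -/
theorem ker_comap_eq {X Y U V : Scheme.{0}} {f' : U ⟶ V} {iU : U ⟶ X} {iV : V ⟶ Y} {f : X ⟶ Y}
    [QuasiCompact f] [QuasiCompact f'] [IsOpenImmersion iV] (H : IsPullback f' iU iV f) :
    f.ker.comap iV = f'.ker := by
  ext U : 2
  rw [Scheme.IdealSheafData.ideal_comap_of_isOpenImmersion,
      Scheme.ker_ideal_of_isPullback_of_isOpenImmersion _ _ _ _ H]

theorem ker_SpecMap_eq {A B B' : Type} [CommRing A] [CommRing B] [CommRing B'] (φ : A →+* B)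
    (φ' : A →+* B')
    (h : RingHom.ker φ = RingHom.ker φ') :
    (Spec.map (CommRingCat.ofHom φ)).ker = (Spec.map (CommRingCat.ofHom φ')).ker := by
  have key : ∀ {C : Type} [CommRing C] (g : A →+* C),
      RingHom.ker (Spec.map (CommRingCat.ofHom g)).appTop.hom =
        (RingHom.ker g).comap (Scheme.ΓSpecIso (.of A)).hom.hom := by
    intro C _ g
    have := Scheme.ΓSpecIso_naturality (CommRingCat.ofHom g)
    rw [← RingHom.ker_equiv_comp _ (Scheme.ΓSpecIso (.of C)).commRingCatIsoToRingEquiv,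
        RingHom.comap_ker]
    exact congrArg (fun q => RingHom.ker (CommRingCat.Hom.hom q)) this
  refine Scheme.IdealSheafData.ext_of_isAffine ?_
  rw [Scheme.Hom.ker_apply, Scheme.Hom.ker_apply]
  exact (key φ).trans ((congrArg _ h).trans (key φ').symm)

instance (n : ℕ) : IsZariskiLocalAtSource (@SmoothOfRelativeDimension.{0} n) :=
  HasRingHomProperty.instIsZariskiLocalAtSource

instance (n : ℕ) : MorphismProperty.RespectsIso (@SmoothOfRelativeDimension.{0} n) :=
  (HasRingHomProperty.instIsZariskiLocalAtSource : IsZariskiLocalAtSource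
      (@SmoothOfRelativeDimension.{0} n)).toRespects

/-- Smoothness of the scheme-theoretic image of `f : Y ⟶ X` can be tested on an affine open cover
`χ` of `X`: if the preimage of a chart `Spec A` is `Spec B`, then the image restricts to
`Spec (A / ker (A → B))` on that chart. -/
theorem smoothOfRelativeDimension_image {n : ℕ} {X Y S : Scheme.{0}} (f : Y ⟶ X) [QuasiCompact f]
    (s : X ⟶ S)
    {ι : Type} (A B : ι → Type) [∀ i, CommRing (A i)] [∀ i, CommRing (B i)]
    (χ : ∀ i, Spec (.of (A i)) ⟶ X) [∀ i, IsOpenImmersion (χ i)]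
    (hχ : ∀ x : X, ∃ i, x ∈ Set.range (χ i))
    (ψ : ∀ i, Spec (.of (B i)) ⟶ Y) [∀ i, IsOpenImmersion (ψ i)]
    (φ : ∀ i, A i →+* B i)
    (w : ∀ i, ψ i ≫ f = Spec.map (CommRingCat.ofHom (φ i)) ≫ χ i)
    (hr : ∀ i, f ⁻¹ᵁ (χ i).opensRange = (ψ i).opensRange)
    (hs : ∀ i, SmoothOfRelativeDimension n
      (Spec.map (CommRingCat.ofHom (Ideal.Quotient.mk (RingHom.ker (φ i)))) ≫ χ i ≫ s)) :
    SmoothOfRelativeDimension n (f.imageι ≫ s) := by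
  let 𝒰 : X.OpenCover :=
    { I₀ := ι
      X := fun i => Spec (.of (A i))
      f := χ
      mem₀ := by
        rw [Scheme.presieve₀_mem_precoverage_iff]
        exact ⟨fun x => by simpa using hχ x, fun i => inferInstance⟩ }
  refine IsZariskiLocalAtSource.of_openCover (𝒰.pullback₁ f.imageι) fun (i : ι) => ?_
  change SmoothOfRelativeDimension n (pullback.fst f.imageι (χ i) ≫ f.imageι ≫ s)
  rw [pullback.condition_assoc]
  let π := Spec.map (CommRingCat.ofHom (Ideal.Quotient.mk (RingHom.ker (φ i))))
  have hπc : IsClosedImmersion π := IsClosedImmersion.spec_of_surjective _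
      Ideal.Quotient.mk_surjective
  have hsc : IsClosedImmersion (pullback.snd f.imageι (χ i)) := inferInstance
  have H := IsOpenImmersion.isPullback _ _ _ _ (w i) (hr i)
  have h1 : f.ker.comap (χ i) = (Spec.map (CommRingCat.ofHom (φ i))).ker := ker_comap_eq H
  have h2 : f.ker.comap (χ i) = (pullback.snd f.imageι (χ i)).ker := by
    have := ker_comap_eq (IsPullback.of_hasPullback f.imageι (χ i)).flip
    rwa [Scheme.IdealSheafData.ker_subschemeι] at this
  have h3 : π.ker = (Spec.map (CommRingCat.ofHom (φ i))).ker := by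
    exact ker_SpecMap_eq _ _ (Ideal.mk_ker)
  have := IsClosedImmersion.isIso_lift (pullback.snd f.imageι (χ i)) π
    (h2.symm.trans (h1.trans h3.symm))
  rw [← MorphismProperty.cancel_left_of_respectsIso (@SmoothOfRelativeDimension n)
    (IsClosedImmersion.lift (pullback.snd f.imageι (χ i)) π
      (h2.symm.trans (h1.trans h3.symm)).le),
    IsClosedImmersion.lift_fac_assoc]
  exact hs i

end

/-! ### The Jacobian criterion for plane curves -/

section

open MvPolynomial

/-- The curve `G = 0` is standard smooth where a partial derivative of `G` is invertible. -/
theorem isStandardSmooth_away (G : MvPolynomial (Fin 2) ℚ) (i : Fin 2) :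
    Algebra.IsStandardSmoothOfRelativeDimension 1 ℚ
      (Localization.Away (Ideal.Quotient.mk (Ideal.span {G}) (pderiv i G))) := by
  suffices H : ∀ I : Ideal (MvPolynomial (Fin 2) ℚ), I = Ideal.span (Set.range fun _ : Unit => G) →
      Algebra.IsStandardSmoothOfRelativeDimension 1 ℚ
        (Localization.Away (Ideal.Quotient.mk I (pderiv i G))) from H _ (by simp)
  rintro _ rfl
  set q := Ideal.Quotient.mk (Ideal.span (Set.range fun _ : Unit => G)) (pderiv i G)
  let P := Algebra.PreSubmersivePresentation.naive (R := ℚ) (v := fun _ : Unit => G) (fun _ => i)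
    (Function.injective_of_subsingleton _)
  let Q := Algebra.PreSubmersivePresentation.localizationAway (Localization.Away q) q
  have hP : P.jacobian = q := by
    rw [Algebra.PreSubmersivePresentation.jacobian_eq_jacobiMatrix_det, Matrix.det_unique]
    exact congrArg (Ideal.Quotient.mk _)
      (Algebra.PreSubmersivePresentation.jacobiMatrix_naive _ _ _ _ _ _)
  have hQ : Q.jacobian = algebraMap _ _ q :=
    Algebra.PreSubmersivePresentation.localizationAway_jacobian q
  have hu : IsUnit (Q.comp P).jacobian := by
    rw [Algebra.PreSubmersivePresentation.comp_jacobian_eq_jacobian_smul_jacobian, hP, hQ,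
      Algebra.smul_def]
    exact (IsLocalization.Away.algebraMap_isUnit q).mul (IsLocalization.Away.algebraMap_isUnit q)
  refine Algebra.SubmersivePresentation.isStandardSmoothOfRelativeDimension
    { Q.comp P with jacobian_isUnit := hu } ?_
  simp [Algebra.Presentation.dimension]

/-- The Jacobian criterion for the plane curve `G = 0`. -/
theorem locally_isStandardSmooth (G : MvPolynomial (Fin 2) ℚ)
    (h : (1 : MvPolynomial (Fin 2) ℚ) ∈ Ideal.span {G, pderiv 0 G, pderiv 1 G}) :
    RingHom.Locally (RingHom.IsStandardSmoothOfRelativeDimension 1)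
      (algebraMap ℚ (MvPolynomial (Fin 2) ℚ ⧸ Ideal.span {G})) := by
  refine ⟨{Ideal.Quotient.mk _ (pderiv 0 G), Ideal.Quotient.mk _ (pderiv 1 G)}, ?_, ?_⟩
  · rw [Ideal.eq_top_iff_one]
    have := Ideal.mem_map_of_mem (Ideal.Quotient.mk (Ideal.span {G})) h
    rwa [Ideal.map_span, Set.image_insert_eq, Set.image_insert_eq, Set.image_singleton, map_one,
      Ideal.Quotient.eq_zero_iff_mem.2 (Ideal.mem_span_singleton_self G),
      Ideal.span_insert_zero] at this
  · have key : ∀ i, RingHom.IsStandardSmoothOfRelativeDimension 1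
        ((algebraMap (MvPolynomial (Fin 2) ℚ ⧸ Ideal.span {G})
          (Localization.Away (Ideal.Quotient.mk (Ideal.span {G}) (pderiv i G)))).comp
            (algebraMap ℚ _)) := fun i => by
      rw [← IsScalarTower.algebraMap_eq, RingHom.isStandardSmoothOfRelativeDimension_algebraMap]
      exact isStandardSmooth_away G i
    rintro t (rfl | rfl)
    exacts [key 0, key 1]

end

/-! ### Points of the projective line with given coordinates -/

section

open HomogeneousLocalization

variable {R S : Type} [CommRing R] [CommRing S] [Algebra ℚ R] [Algebra ℚ S]

/-- Evaluation of a degree zero fraction with denominator a power of `F` at a vector `x` for which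
`F(x)` is invertible. -/
def evalAway (F : PlaneRing) (x : Fin 2 → R) (h : IsUnit (MvPolynomial.aeval x F)) :
    Away grading F →+* R :=
  (IsLocalization.Away.lift (S := Localization.Away F)
    (g := (MvPolynomial.aeval (R := ℚ) x).toRingHom) F h).comp
  (algebraMap (Away grading F) (Localization.Away F))

theorem evalAway_mk {F : PlaneRing} {d : ℕ} (hF : F ∈ grading d) (x : Fin 2 → R)
    (h : IsUnit (MvPolynomial.aeval x F)) (n : ℕ) (p : PlaneRing) (hp : p ∈ grading (n • d)) :
    evalAway F x h (Away.mk grading hF n p hp) * (MvPolynomial.aeval x F) ^ n =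
      MvPolynomial.aeval x p := by
  have h1 : algebraMap (Away grading F) (Localization.Away F) (Away.mk grading hF n p hp) *
      algebraMap PlaneRing _ F ^ n = algebraMap PlaneRing _ p := by
    rw [HomogeneousLocalization.algebraMap_apply, Away.val_mk, Localization.mk_eq_mk', ← map_pow]
    exact IsLocalization.mk'_spec _ p (⟨F ^ n, n, rfl⟩ : Submonoid.powers F)
  have h2 := congrArg (IsLocalization.Away.lift (S := Localization.Away F)
    (g := (MvPolynomial.aeval (R := ℚ) x).toRingHom) F h) h1
  rw [map_mul, map_pow, IsLocalization.Away.lift_eq, IsLocalization.Away.lift_eq] at h2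
  exact h2

/-- Degree zero fractions take the same value at proportional vectors. -/
theorem evalAway_smul {F : PlaneRing} {d : ℕ} (hF : F ∈ grading d) (x : Fin 2 → R) (a : R)
    (h : IsUnit (MvPolynomial.aeval x F)) (h' : IsUnit (MvPolynomial.aeval (a • x) F)) :
    evalAway F (a • x) h' = evalAway F x h := by
  have hom : ∀ {n : ℕ} {p : PlaneRing}, p ∈ grading n →
      MvPolynomial.aeval (a • x) p = a ^ n * MvPolynomial.aeval x p := by
    intro n p hp
    have := (MvPolynomial.mem_homogeneousSubmodule n p).1 hp
    rw [MvPolynomial.aeval_def, MvPolynomial.aeval_def, MvPolynomial.eval₂_eq,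
        MvPolynomial.eval₂_eq,
      Finset.mul_sum]
    refine Finset.sum_congr rfl fun m hm => ?_
    have hdeg : ∑ i ∈ m.support, m i = n := by
      exact (this.degree_eq_sum_deg_support hm).symm
    simp only [Pi.smul_apply, smul_eq_mul, mul_pow, Finset.prod_mul_distrib,
      Finset.prod_pow_eq_pow_sum, hdeg]
    ring
  ext z
  obtain ⟨n, p, hp, rfl⟩ := Away.mk_surjective grading hF z
  refine (h'.pow n).mul_left_injective ?_
  change _ * _ = _ * _
  rw [evalAway_mk, hom hp, hom hF, mul_pow, ← evalAway_mk hF x h n p hp, smul_eq_mul, mul_comm n d,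
      pow_mul]
  ring

theorem comp_evalAway (g : R →ₐ[ℚ] S) (F : PlaneRing) (x : Fin 2 → R)
    (h : IsUnit (MvPolynomial.aeval x F))
    (h' : IsUnit (MvPolynomial.aeval (g ∘ x) F)) :
    g.toRingHom.comp (evalAway F x h) = evalAway F (g ∘ x) h' := by
  rw [evalAway, evalAway, ← RingHom.comp_assoc]
  congr 1
  refine IsLocalization.ringHom_ext (Submonoid.powers F) ?_
  ext i <;> simp

theorem evalAway_comp_awayMap {F G H : PlaneRing} {e : ℕ} (hG : G ∈ grading e) (hH : H = F * G)
    (x : Fin 2 → R)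
    (h : IsUnit (MvPolynomial.aeval x F)) (h' : IsUnit (MvPolynomial.aeval x H)) :
    (evalAway H x h').comp (awayMap grading hG hH) = evalAway F x h := by
  ext z
  simp only [evalAway, RingHom.comp_apply, HomogeneousLocalization.algebraMap_apply, val_awayMap]
  rw [← RingHom.comp_apply]
  congr 1
  refine IsLocalization.ringHom_ext (Submonoid.powers F) ?_
  ext i <;> simp [Localization.awayLift]

/-- The point of `ℙ¹` with homogeneous coordinates `x`, as a morphism through the basic open
`F ≠ 0`. -/
def pt {F : PlaneRing} {d : ℕ} (hF : F ∈ grading d) (hd : 0 < d) (x : Fin 2 → R)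
    (h : IsUnit (MvPolynomial.aeval x F)) : Spec (.of R) ⟶ P1 :=
  Spec.map (CommRingCat.ofHom (evalAway F x h)) ≫ Proj.awayι grading F hF hd

theorem pt_mul {F G : PlaneRing} {d e : ℕ} (hF : F ∈ grading d) (hd : 0 < d) (hG : G ∈ grading e)
    (x : Fin 2 → R) (h : IsUnit (MvPolynomial.aeval x F))
        (h' : IsUnit (MvPolynomial.aeval x (F * G))) :
    pt (SetLike.mul_mem_graded hF hG) (hd.trans_le (d.le_add_right e)) x h' = pt hF hd x h := by
  rw [pt, pt, ← evalAway_comp_awayMap hG rfl x h h', CommRingCat.ofHom_comp, Spec.map_comp,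
    Category.assoc, Proj.SpecMap_awayMap_awayι]

theorem pt_congr {F F' : PlaneRing} {d d' : ℕ} (hF : F ∈ grading d) (hd : 0 < d)
    (hF' : F' ∈ grading d') (hd' : 0 < d') (x : Fin 2 → R)
    (h : IsUnit (MvPolynomial.aeval x F)) (h' : IsUnit (MvPolynomial.aeval x F'))
    (e : F = F') (e' : d = d') : pt hF hd x h = pt hF' hd' x h' := by
  subst e e'
  rfl

/-- The point does not depend on the basic open used to define it. -/
theorem pt_eq {F G : PlaneRing} {d e : ℕ} (hF : F ∈ grading d) (hd : 0 < d) (hG : G ∈ grading e)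
    (he : 0 < e)
    (x : Fin 2 → R) (h : IsUnit (MvPolynomial.aeval x F)) (h' : IsUnit (MvPolynomial.aeval x G)) :
    pt hF hd x h = pt hG he x h' := by
  rw [← pt_mul hF hd hG x h (by rw [map_mul]; exact h.mul h'),
    ← pt_mul hG he hF x h' (by rw [map_mul]; exact h'.mul h)]
  exact pt_congr _ _ _ _ _ _ _ (mul_comm F G) (add_comm d e)

theorem map_pt (g : R →ₐ[ℚ] S) {F : PlaneRing} {d : ℕ} (hF : F ∈ grading d) (hd : 0 < d)
    (x : Fin 2 → R)
    (h : IsUnit (MvPolynomial.aeval x F)) (h' : IsUnit (MvPolynomial.aeval (g ∘ x) F)) :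
    Spec.map (CommRingCat.ofHom g.toRingHom) ≫ pt hF hd x h = pt hF hd (g ∘ x) h' := by
  rw [pt, pt, ← comp_evalAway g F x h h', CommRingCat.ofHom_comp, Spec.map_comp, Category.assoc]

theorem pt_toSpec {F : PlaneRing} {d : ℕ} (hF : F ∈ grading d) (hd : 0 < d) (x : Fin 2 → R)
    (h : IsUnit (MvPolynomial.aeval x F)) :
    pt hF hd x h ≫ P1.toSpec = Spec.map (CommRingCat.ofHom (algebraMap ℚ R)) := by
  rw [pt, P1.toSpec, Category.assoc, Proj.awayι_toSpecZero_assoc, ← Spec.map_comp,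
    ← Spec.map_comp, ← CommRingCat.ofHom_comp, ← CommRingCat.ofHom_comp]
  congr 2
  exact Subsingleton.elim _ _

/-- The homogeneous coordinates `(a : 1)` for `e = 0` and `(1 : a)` for `e = 1`. -/
def coord (e : Fin 2) (a : R) : Fin 2 → R := fun i => if i = e then a else 1

theorem aeval_coord (e : Fin 2) (a : R) :
    IsUnit (MvPolynomial.aeval (coord e a) (MvPolynomial.X (e + 1) : PlaneRing)) := by
  have : e + 1 ≠ e := by decide +revert
  simp [coord, this]

theorem X_mem (i : Fin 2) : (MvPolynomial.X i : PlaneRing) ∈ grading 1 :=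
  (MvPolynomial.mem_homogeneousSubmodule 1 _).2 (MvPolynomial.isHomogeneous_X ℚ i)

/-- The point `(a : 1)` of `ℙ¹` for `e = 0`, and the point `(1 : a)` for `e = 1`. -/
def linePt (e : Fin 2) (a : R) : Spec (.of R) ⟶ P1 :=
  pt (X_mem (e + 1)) one_pos (coord e a) (aeval_coord e a)

theorem linePt_zero (a : R) : linePt 0 a = toP1 a := by
  have : coord 0 a = ![a, 1] := by
    ext i; fin_cases i <;> simp [coord]
  rw [linePt]
  simp only [this]
  rfl

theorem map_linePt (g : R →ₐ[ℚ] S) (e : Fin 2) (a : R) :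
    Spec.map (CommRingCat.ofHom g.toRingHom) ≫ linePt e a = linePt e (g a) := by
  have : g ∘ coord e a = coord e (g a) := by
    ext i; simp only [coord, Function.comp]; split_ifs <;> simp
  rw [linePt, map_pt g _ _ _ _ (by rw [this]; exact aeval_coord e _)]
  simp only [this]
  rfl

theorem linePt_one_eq {a b : R} (h : a * b = 1) : linePt 0 a = linePt 1 b := by
  have ha : IsUnit a := .of_mul_eq_one _ h
  have hb : IsUnit b := .of_mul_eq_one _ ((mul_comm b a).trans h)
  have : coord 0 a = a • coord 1 b := by
    ext i; fin_cases i <;> simp [coord, h]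
  have hu : IsUnit (MvPolynomial.aeval (a • coord 1 b) (MvPolynomial.X 0 : PlaneRing)) := by
    simp [coord, ha]
  have h1 : linePt 0 a = pt (X_mem 0) one_pos (a • coord 1 b) hu := by
    rw [linePt]
    simp only [this]
    exact pt_eq _ _ _ _ _ _ _
  rw [h1, linePt, pt, pt, evalAway_smul (X_mem 0)]
  rfl

theorem linePt_toSpec (e : Fin 2) (a : R) :
    linePt e a ≫ P1.toSpec = Spec.map (CommRingCat.ofHom (algebraMap ℚ R)) := pt_toSpec _ _ _ _

/-- The coordinate ring of each standard chart of `ℙ¹` is the polynomial ring in one variable. -/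
theorem evalAway_coord_bijective (e : Fin 2) :
    Function.Bijective (evalAway (MvPolynomial.X (e + 1)) (coord e (Polynomial.X : Polynomial ℚ))
        (aeval_coord e _)) := by
  have he : e + 1 ≠ e := by decide +revert
  constructor
  · rw [injective_iff_map_eq_zero]
    intro z hz
    obtain ⟨n, p, hp, rfl⟩ := Away.mk_surjective grading (X_mem (e + 1)) z
    have h1 := evalAway_mk (X_mem (e + 1)) (coord e (Polynomial.X : Polynomial ℚ)) (aeval_coord e _)
        n p hp
    rw [hz, zero_mul] at h1
    suffices hp0 : p = 0 by
      subst hp0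
      exact HomogeneousLocalization.mk_eq_zero_of_num _ rfl
    have hh := (MvPolynomial.mem_homogeneousSubmodule _ p).1 hp
    have hc : coord e (Polynomial.X : Polynomial ℚ) = ![Polynomial.X, 1] ∘ Equiv.addRight e := by
      ext1 i; fin_cases e <;> fin_cases i <;> simp [coord]
    rw [hc, ← MvPolynomial.aeval_rename] at h1
    have h2 := Polynomial.homogenize_eq_of_isHomogeneous
      (hh.rename_isHomogeneous (f := Equiv.addRight e)) h1.symm
    refine MvPolynomial.rename_injective _ (Equiv.addRight e).injective ?_
    rw [map_zero, ← h2, Polynomial.homogenize_zero]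
  · intro q
    let ψ : Polynomial ℚ →+* Away grading (MvPolynomial.X (e + 1) : PlaneRing) :=
      Polynomial.eval₂RingHom ((fromZeroRingHom grading _).comp (algebraMap ℚ (grading 0)))
        (Away.mk grading (X_mem (e + 1)) 1 (MvPolynomial.X e) (X_mem e))
    refine ⟨ψ q, ?_⟩
    rw [← RingHom.comp_apply]
    suffices h : RingHom.comp _ ψ = RingHom.id _ from congrArg (fun g => g q) h
    refine Polynomial.ringHom_ext' (Subsingleton.elim _ _) ?_
    have := evalAway_mk (X_mem (e + 1)) (coord e (Polynomial.X : Polynomial ℚ)) (aeval_coord e _) 1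
        (MvPolynomial.X e) (X_mem e)
    simpa [ψ, coord, he] using this

instance (e : Fin 2) : IsOpenImmersion (linePt e (Polynomial.X : Polynomial ℚ)) := by
  have : IsIso (CommRingCat.ofHom (evalAway (MvPolynomial.X (e + 1))
      (coord e (Polynomial.X : Polynomial ℚ)) (aeval_coord e _))) :=
    (ConcreteCategory.isIso_iff_bijective _).2 (evalAway_coord_bijective e)
  rw [linePt, pt]
  infer_instance

end

/-! ### The four charts of `ℙ¹ × ℙ¹` -/

section

open HomogeneousLocalization

variable {R S : Type} [CommRing R] [CommRing S]

/-- The relation between the affine coordinate `a` of a point of `ℙ¹` and its coordinate `b` in the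
chart `e`: they are equal for `e = 0` and inverse to each other for `e = 1`. -/
def CoordRel (e : Fin 2) (a b : R) : Prop :=
  if e = 0 then b = a else a * b = 1

theorem CoordRel.symm {e : Fin 2} {a b : R} (h : CoordRel e a b) : CoordRel e b a := by
  unfold CoordRel at *
  split_ifs at * with he
  · exact h.symm
  · rwa [mul_comm]

theorem CoordRel.unique {e : Fin 2} {a b c : R} (h : CoordRel e a b) (h' : CoordRel e a c) :
    b = c := by
  unfold CoordRel at *
  split_ifs at * with he
  · rw [h, h']
  · rw [← one_mul b, ← h', mul_right_comm, h, one_mul]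

/-- The function that has to be invertible for the coordinate in the chart `e` to be defined. -/
def den (e : Fin 2) (a : R) : R := if e = 0 then 1 else a

theorem exists_coordRel {e : Fin 2} {a : R} (h : IsUnit (den e a)) : ∃ b, CoordRel e a b := by
  unfold den at h
  unfold CoordRel
  split_ifs at * with he
  · exact ⟨a, rfl⟩
  · exact h.exists_right_inv

theorem CoordRel.isUnit_den {e : Fin 2} {a b : R} (h : CoordRel e a b) : IsUnit (den e a) := by
  unfold den CoordRel at *
  split_ifs at * with he
  · exact isUnit_one
  · exact .of_mul_eq_one _ h

theorem map_den (g : R →+* S) (e : Fin 2) (a : R) : g (den e a) = den e (g a) := by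
  unfold den; split_ifs <;> simp

variable [Algebra ℚ R] [Algebra ℚ S]

theorem CoordRel.map {e : Fin 2} {a b : R} (h : CoordRel e a b) (g : R →ₐ[ℚ] S) :
    CoordRel e (g a) (g b) := by
  unfold CoordRel at *
  split_ifs at * with he
  · rw [h]
  · rw [← map_mul, h, map_one]

theorem linePt_eq_of_coordRel {e : Fin 2} {a b : R} (h : CoordRel e a b) :
    linePt 0 a = linePt e b := by
  fin_cases e
  · obtain rfl : b = a := h
    rfl
  · exact linePt_one_eq h

theorem opensRange_linePt (e : Fin 2) : (linePt e (Polynomial.X : Polynomial ℚ)).opensRange =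
      Proj.basicOpen grading (MvPolynomial.X (e + 1)) := by
  have : IsIso (CommRingCat.ofHom (evalAway (MvPolynomial.X (e + 1))
      (coord e (Polynomial.X : Polynomial ℚ)) (aeval_coord e _))) :=
    (ConcreteCategory.isIso_iff_bijective _).2 (evalAway_coord_bijective e)
  rw [← Proj.opensRange_awayι grading _ (X_mem (e + 1)) one_pos]
  exact Scheme.Hom.opensRange_comp_of_isIso _ _

theorem evalAway_isLocalizationElem (e : Fin 2) (a : R) :
    evalAway (MvPolynomial.X (0 + 1)) (coord 0 a) (aeval_coord 0 a)
      (Away.isLocalizationElem (X_mem (0 + 1)) (X_mem (e + 1))) = den e a := by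
  have h2 := evalAway_mk (X_mem (0 + 1)) (coord 0 a) (aeval_coord 0 a) 1
      (MvPolynomial.X (e + 1) ^ 1)
    (by simpa using X_mem (e + 1))
  have h4 : MvPolynomial.aeval (coord 0 a) (MvPolynomial.X (0 + 1) : PlaneRing) = 1 := by
    simp [coord]
  rw [h4, one_pow, mul_one] at h2
  refine h2.trans ?_
  fin_cases e <;> simp [coord, den]

theorem linePt_preimage (e : Fin 2) (a : R) :
    linePt 0 a ⁻¹ᵁ (linePt e (Polynomial.X : Polynomial ℚ)).opensRange =
      PrimeSpectrum.basicOpen (den e a) := by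
  rw [opensRange_linePt, ← evalAway_isLocalizationElem]
  exact congrArg (fun U => (Spec.map (CommRingCat.ofHom (evalAway (MvPolynomial.X (0 + 1))
      (coord 0 a)
    (aeval_coord 0 a)))) ⁻¹ᵁ U)
    (Proj.awayι_preimage_basicOpen grading (X_mem (0 + 1)) one_pos (X_mem (e + 1)) one_pos)

theorem exists_mem_range_linePt (x : P1) :
    ∃ e, x ∈ Set.range (linePt e (Polynomial.X : Polynomial ℚ)) := by
  have h := Proj.iSup_basicOpen_eq_top' grading (fun i : Fin 2 => (MvPolynomial.X i : PlaneRing))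
    (fun i => ⟨1, X_mem i⟩) (by
      refine top_le_iff.1 fun p _ => ?_
      induction p using MvPolynomial.induction_on with
      | C a =>
        exact Subalgebra.algebraMap_mem _ (⟨MvPolynomial.C a,
          (MvPolynomial.mem_homogeneousSubmodule 0 _).2 (MvPolynomial.isHomogeneous_C _ a)⟩ :
              grading 0)
      | add p q hp hq => exact add_mem (hp trivial) (hq trivial)
      | mul_X p i hp => exact mul_mem (hp trivial) (Algebra.subset_adjoin ⟨i, rfl⟩))
  obtain ⟨i, hi⟩ := TopologicalSpace.Opens.mem_iSup.1 (h.ge (Set.mem_univ x))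
  refine ⟨i + 1, ?_⟩
  have h2 : i + 1 + 1 = i := by fin_cases i <;> rfl
  have := opensRange_linePt (i + 1)
  rw [h2] at this
  exact this.ge hi

/-- The open immersion of the affine plane in `ℙ¹ × ℙ¹` given by the charts `e` and `e'`. -/
def planeChart (e e' : Fin 2) : Spec (.of PlaneRing) ⟶ P1xP1 :=
  pullback.lift (linePt e r) (linePt e' t) (by rw [linePt_toSpec, linePt_toSpec])

/-- The affine plane is the product of two affine lines. -/
theorem isPullback_plane : IsPullback
    (Spec.map (CommRingCat.ofHom (Polynomial.aeval r : Polynomial ℚ →ₐ[ℚ] PlaneRing).toRingHom))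
    (Spec.map (CommRingCat.ofHom (Polynomial.aeval t : Polynomial ℚ →ₐ[ℚ] PlaneRing).toRingHom))
    (Spec.map (CommRingCat.ofHom (algebraMap ℚ (Polynomial ℚ))))
    (Spec.map (CommRingCat.ofHom (algebraMap ℚ (Polynomial ℚ)))) := by
  refine isPullback_SpecMap_of_isPushout _ _ _ _ ?_
  refine ⟨⟨?_⟩, ⟨PushoutCocone.IsColimit.mk _
    (fun s => CommRingCat.ofHom (MvPolynomial.eval₂Hom (s.inl.hom.comp Polynomial.C)
      ![s.inl.hom Polynomial.X, s.inr.hom Polynomial.X])) ?_ ?_ ?_⟩⟩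
  · rw [← CommRingCat.ofHom_comp, ← CommRingCat.ofHom_comp]
    congr 1
    exact Subsingleton.elim _ _
  · intro s
    ext1
    refine Polynomial.ringHom_ext' (Subsingleton.elim _ _) ?_
    simp [r]
  · intro s
    ext1
    refine Polynomial.ringHom_ext' (Subsingleton.elim _ _) ?_
    simp [t]
  · intro s m h1 h2
    ext1
    refine MvPolynomial.ringHom_ext' (Subsingleton.elim _ _) fun i => ?_
    rw [← h1, ← h2]
    fin_cases i
    · simp [r]
    · simp [t]

theorem planeChart_eq (e e' : Fin 2) : planeChart e e' = isPullback_plane.isoPullback.hom ≫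
    pullback.map _ _ P1.toSpec P1.toSpec (linePt e (Polynomial.X : Polynomial ℚ))
      (linePt e' (Polynomial.X : Polynomial ℚ)) (𝟙 _)
      (by rw [linePt_toSpec, Category.comp_id]) (by rw [linePt_toSpec, Category.comp_id]) := by
  apply pullback.hom_ext
  · rw [planeChart, pullback.lift_fst, Category.assoc, pullback.map, pullback.lift_fst,
      IsPullback.isoPullback_hom_fst_assoc, map_linePt, Polynomial.aeval_X]
  · rw [planeChart, pullback.lift_snd, Category.assoc, pullback.map, pullback.lift_snd,
      IsPullback.isoPullback_hom_snd_assoc, map_linePt, Polynomial.aeval_X]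

instance (e e' : Fin 2) : IsOpenImmersion (planeChart e e') := by
  rw [planeChart_eq]
  infer_instance

theorem range_planeChart (e e' : Fin 2) : Set.range (planeChart e e') =
    pullback.fst P1.toSpec P1.toSpec ⁻¹' Set.range (linePt e (Polynomial.X : Polynomial ℚ)) ∩
      pullback.snd P1.toSpec P1.toSpec ⁻¹' Set.range (linePt e' (Polynomial.X : Polynomial ℚ)) := by
  have hs : Set.range isPullback_plane.isoPullback.hom = Set.univ :=
    Set.range_eq_univ.2 isPullback_plane.isoPullback.hom.homeomorph.surjective
  rw [planeChart_eq, Scheme.Hom.comp_base, TopCat.coe_comp, Set.range_comp, hs, Set.image_univ]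
  exact Scheme.Pullback.range_map ..

end

/-! ### The equation of a projective closure in each chart -/

section

theorem aeval_coords {B : Type} [CommRing B] [Algebra ℚ B] (g : PlaneRing →ₐ[ℚ] B) :
    g = MvPolynomial.aeval ![g r, g t] := by
  ext i
  fin_cases i <;> simp [r, t]

theorem isUnit_map_mul {A B : Type} [CommRing A] [CommRing B] (g : A →+* B) (a b : A) :
    IsUnit (g (a * b)) ↔ IsUnit (g a) ∧ IsUnit (g b) := by
  rw [map_mul, IsUnit.mul_iff]

/-- The coordinate ring of the open subscheme of the affine curve with ideal `I` that lies in the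
chart `(e, e')`. -/
abbrev Overlap (e e' : Fin 2) (I : Ideal PlaneRing) : Type :=
  Localization.Away (Ideal.Quotient.mk I (den e r * den e' t))

/-- The restriction to the overlap of a polynomial in the affine coordinates. -/
def toOverlap (e e' : Fin 2) (I : Ideal PlaneRing) : PlaneRing →ₐ[ℚ] Overlap e e' I :=
  (Algebra.ofId (PlaneRing ⧸ I) (Overlap e e' I)).restrictScalars ℚ |>.comp
    (Ideal.Quotient.mkₐ ℚ I)

theorem toOverlap_apply (e e' : Fin 2) (I : Ideal PlaneRing) (p : PlaneRing) :
    toOverlap e e' I p = algebraMap _ (Overlap e e' I) (Ideal.Quotient.mk I p) := rfl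

theorem exists_overlap_coord (e e' : Fin 2) (I : Ideal PlaneRing) :
    (∃ a, CoordRel e (toOverlap e e' I r) a) ∧ ∃ b, CoordRel e' (toOverlap e e' I t) b := by
  have h : IsUnit (toOverlap e e' I (den e r * den e' t)) :=
    IsLocalization.Away.algebraMap_isUnit (Ideal.Quotient.mk I (den e r * den e' t))
  replace h := (isUnit_map_mul (toOverlap e e' I).toRingHom _ _).1 h
  exact ⟨exists_coordRel ((map_den (toOverlap e e' I).toRingHom e r).symm ▸ h.1),
    exists_coordRel ((map_den (toOverlap e e' I).toRingHom e' t).symm ▸ h.2)⟩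

/-- The first coordinate of the chart `(e, e')`, as a function on the overlap. -/
def overlapFst (e e' : Fin 2) (I : Ideal PlaneRing) : Overlap e e' I :=
  (exists_overlap_coord e e' I).1.choose

/-- The second coordinate of the chart `(e, e')`, as a function on the overlap. -/
def overlapSnd (e e' : Fin 2) (I : Ideal PlaneRing) : Overlap e e' I :=
  (exists_overlap_coord e e' I).2.choose

theorem coordRel_overlapFst (e e' : Fin 2) (I : Ideal PlaneRing) :
    CoordRel e (toOverlap e e' I r) (overlapFst e e' I) :=
  (exists_overlap_coord e e' I).1.choose_spec

theorem coordRel_overlapSnd (e e' : Fin 2) (I : Ideal PlaneRing) :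
    CoordRel e' (toOverlap e e' I t) (overlapSnd e e' I) :=
  (exists_overlap_coord e e' I).2.choose_spec

/-- The restriction to the overlap of a polynomial in the coordinates of the chart `(e, e')`. -/
def changeCoord (e e' : Fin 2) (I : Ideal PlaneRing) : PlaneRing →ₐ[ℚ] Overlap e e' I :=
  MvPolynomial.aeval ![overlapFst e e' I, overlapSnd e e' I]

theorem changeCoord_r (e e' : Fin 2) (I : Ideal PlaneRing) :
    changeCoord e e' I r = overlapFst e e' I := by simp [changeCoord, r]

theorem changeCoord_t (e e' : Fin 2) (I : Ideal PlaneRing) :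
    changeCoord e e' I t = overlapSnd e e' I := by simp [changeCoord, t]

theorem toOverlap_self {e e' : Fin 2} {G : PlaneRing} : toOverlap e e' (Ideal.span {G}) G = 0 := by
  rw [toOverlap_apply, Ideal.Quotient.eq_zero_iff_mem.2 (Ideal.mem_span_singleton_self G), map_zero]

theorem dvd_of_toOverlap_eq_zero {e e' : Fin 2} {G p : PlaneRing}
    (hr : e = 1 → ¬ r ∣ G) (ht : e' = 1 → ¬ t ∣ G)
    (h : toOverlap e e' (Ideal.span {G}) p = 0) : G ∣ p := by
  rw [toOverlap_apply, IsLocalization.map_eq_zero_iff (Submonoid.powers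
    (Ideal.Quotient.mk (Ideal.span {G}) (den e r * den e' t)))] at h
  obtain ⟨⟨_, n, rfl⟩, h⟩ := h
  simp only [← map_pow, ← map_mul, Ideal.Quotient.eq_zero_iff_mem, Ideal.mem_span_singleton] at h
  have hX : ∀ i : Fin 2, Prime (MvPolynomial.X i : PlaneRing) := fun i => MvPolynomial.X_prime
  have key : IsRelPrime G ((den e r * den e' t) ^ n) := by
    refine IsRelPrime.pow_right (IsRelPrime.mul_right ?_ ?_)
    · unfold den
      split_ifs with he
      · exact isRelPrime_one_right
      · exact ((hX 0).irreducible.isRelPrime_iff_not_dvd.2 (hr (by omega))).symm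
    · unfold den
      split_ifs with he
      · exact isRelPrime_one_right
      · exact ((hX 1).irreducible.isRelPrime_iff_not_dvd.2 (ht (by omega))).symm
  exact key.dvd_of_dvd_mul_left h

/-- A homomorphism that vanishes on `I`, together with compatible values of the coordinates of the
chart, extends to the overlap. -/
theorem exists_overlap_lift {e e' : Fin 2} {I : Ideal PlaneRing} {B : Type} [CommRing B]
    [Algebra ℚ B] (g : PlaneRing →ₐ[ℚ] B) (hg : ∀ p ∈ I, g p = 0) {a b : B}
    (ha : CoordRel e (g r) a) (hb : CoordRel e' (g t) b) :
    ∃ θ : Overlap e e' I →ₐ[ℚ] B, (∀ p, θ (toOverlap e e' I p) = g p) ∧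
      θ.comp (changeCoord e e' I) = MvPolynomial.aeval ![a, b] := by
  let θ₁ : PlaneRing ⧸ I →ₐ[ℚ] B := Ideal.Quotient.liftₐ _ g hg
  have hθ₁ : ∀ a, θ₁ (Ideal.Quotient.mk _ a) = g a := fun a => rfl
  have hu : ∀ y : Submonoid.powers (Ideal.Quotient.mk I (den e r * den e' t)),
      IsUnit (θ₁ y) := by
    rintro ⟨_, n, rfl⟩
    change IsUnit (θ₁ (_ ^ n))
    rw [map_pow, hθ₁]
    refine IsUnit.pow n ((isUnit_map_mul g.toRingHom _ _).2 ⟨?_, ?_⟩)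
    · exact (map_den g.toRingHom e r).symm ▸ ha.isUnit_den
    · exact (map_den g.toRingHom e' t).symm ▸ hb.isUnit_den
  let θ : Overlap e e' I →ₐ[ℚ] B := IsLocalization.liftAlgHom (M := Submonoid.powers
    (Ideal.Quotient.mk I (den e r * den e' t))) (f := θ₁) hu
  have hθ : ∀ a, θ (toOverlap e e' I a) = g a := fun a => IsLocalization.lift_eq hu _
  refine ⟨θ, hθ, ?_⟩
  have h1 := (coordRel_overlapFst e e' I).map θ
  have h2 := (coordRel_overlapSnd e e' I).map θ
  rw [hθ] at h1 h2
  rw [aeval_coords (θ.comp _), AlgHom.comp_apply, AlgHom.comp_apply, changeCoord_r, changeCoord_t,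
    h1.unique ha, h2.unique hb]

/-- If `G` and `H` are the same equation up to units in the affine coordinates and in those of the
chart, and `H` is not divisible by an inverted coordinate, then `H` generates the ideal of the
closure of `G = 0` in the chart. -/
theorem ker_changeCoord {e e' : Fin 2} {G H : PlaneRing}
    (h : ∀ (B : Type) [CommRing B] [Algebra ℚ B] (a b a' b' : B), CoordRel e a a' →
      CoordRel e' b b' → Associated (MvPolynomial.aeval ![a', b'] H) (MvPolynomial.aeval ![a, b] G))
    (hr : e = 1 → ¬ r ∣ H) (ht : e' = 1 → ¬ t ∣ H) :
    RingHom.ker (changeCoord e e' (Ideal.span {G})).toRingHom = Ideal.span {H} := by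
  apply le_antisymm
  · intro p hp
    rw [Ideal.mem_span_singleton]
    refine dvd_of_toOverlap_eq_zero hr ht ?_
    set ρ := toOverlap e e' (Ideal.span {H})
    have hG : changeCoord e e' (Ideal.span {H}) G = 0 := by
      have := h _ _ _ _ _ (coordRel_overlapFst e e' (Ideal.span {H})).symm
        (coordRel_overlapSnd e e' (Ideal.span {H})).symm
      rw [← aeval_coords, toOverlap_self] at this
      exact this.eq_zero_iff.1 rfl
    obtain ⟨θ, -, hc⟩ := exists_overlap_lift (I := Ideal.span {G})
      (changeCoord e e' (Ideal.span {H})) (fun a ha => by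
        obtain ⟨b, rfl⟩ := Ideal.mem_span_singleton.1 ha
        rw [map_mul, hG, zero_mul])
      (a := ρ r) (b := ρ t)
      (by rw [changeCoord_r]; exact (coordRel_overlapFst e e' (Ideal.span {H})).symm)
      (by rw [changeCoord_t]; exact (coordRel_overlapSnd e e' (Ideal.span {H})).symm)
    rw [← aeval_coords] at hc
    rw [← hc, AlgHom.comp_apply]
    exact (congrArg θ hp).trans (map_zero θ)
  · rw [Ideal.span_singleton_le_iff_mem]
    have := h _ _ _ _ _ (coordRel_overlapFst e e' (Ideal.span {G}))
        (coordRel_overlapSnd e e' (Ideal.span {G}))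
    rw [← aeval_coords, toOverlap_self] at this
    exact this.eq_zero_iff.2 rfl

theorem affinePart_eq : affinePart = planeChart 0 0 := by
  apply pullback.hom_ext
  · simp [affinePart, planeChart, linePt_zero]
  · simp [affinePart, planeChart, linePt_zero]

theorem affineCurve_fst (I : Ideal PlaneRing) : affineCurve I ≫ pullback.fst _ _ =
    linePt 0 (Ideal.Quotient.mk I r) := by
  rw [affineCurve, affinePart_eq, planeChart, Category.assoc, pullback.lift_fst]
  exact map_linePt (Ideal.Quotient.mkₐ ℚ I) 0 r

theorem affineCurve_snd (I : Ideal PlaneRing) : affineCurve I ≫ pullback.snd _ _ =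
    linePt 0 (Ideal.Quotient.mk I t) := by
  rw [affineCurve, affinePart_eq, planeChart, Category.assoc, pullback.lift_snd]
  exact map_linePt (Ideal.Quotient.mkₐ ℚ I) 0 t

/-- The inclusion of the overlap in the affine curve. -/
def overlapι (e e' : Fin 2) (I : Ideal PlaneRing) :
    Spec (.of (Overlap e e' I)) ⟶ Spec (.of (PlaneRing ⧸ I)) :=
  Spec.map (CommRingCat.ofHom (algebraMap _ _))

instance (e e' : Fin 2) (I : Ideal PlaneRing) : IsOpenImmersion (overlapι e e' I) :=
  IsOpenImmersion.of_isLocalization (Ideal.Quotient.mk I (den e r * den e' t))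

theorem overlap_comp (e e' : Fin 2) (I : Ideal PlaneRing) :
    overlapι e e' I ≫ affineCurve I =
      Spec.map (CommRingCat.ofHom (changeCoord e e' I).toRingHom) ≫ planeChart e e' := by
  apply pullback.hom_ext
  · rw [Category.assoc, Category.assoc, affineCurve_fst, planeChart, pullback.lift_fst,
      map_linePt, changeCoord_r, ← linePt_eq_of_coordRel (coordRel_overlapFst e e' I)]
    exact map_linePt ((Algebra.ofId (PlaneRing ⧸ I) (Overlap e e' I)).restrictScalars ℚ) 0 _
  · rw [Category.assoc, Category.assoc, affineCurve_snd, planeChart, pullback.lift_snd,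
      map_linePt, changeCoord_t, ← linePt_eq_of_coordRel (coordRel_overlapSnd e e' I)]
    exact map_linePt ((Algebra.ofId (PlaneRing ⧸ I) (Overlap e e' I)).restrictScalars ℚ) 0 _

theorem opensRange_planeChart (e e' : Fin 2) : (planeChart e e').opensRange =
    pullback.fst P1.toSpec P1.toSpec ⁻¹ᵁ (linePt e (Polynomial.X : Polynomial ℚ)).opensRange ⊓
      pullback.snd P1.toSpec P1.toSpec ⁻¹ᵁ (linePt e' (Polynomial.X : Polynomial ℚ)).opensRange :=
  TopologicalSpace.Opens.ext (range_planeChart e e')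

theorem affineCurve_preimage (e e' : Fin 2) (I : Ideal PlaneRing) :
    affineCurve I ⁻¹ᵁ (planeChart e e').opensRange = (overlapι e e' I).opensRange := by
  rw [opensRange_planeChart, Scheme.Hom.preimage_inf, ← Scheme.Hom.comp_preimage,
    ← Scheme.Hom.comp_preimage, affineCurve_fst, affineCurve_snd, linePt_preimage, linePt_preimage,
    ← map_den, ← map_den]
  refine (PrimeSpectrum.basicOpen_mul _ _).symm.trans ?_
  rw [← map_mul]
  apply TopologicalSpace.Opens.ext
  exact (PrimeSpectrum.localization_away_comap_range _ _).symm

theorem planeChart_toSpec (e e' : Fin 2) : planeChart e e' ≫ P1xP1.toSpec =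
    Spec.map (CommRingCat.ofHom (algebraMap ℚ PlaneRing)) := by
  rw [P1xP1.toSpec, planeChart, pullback.lift_fst_assoc, linePt_toSpec]

/-- The closure of `G 0 0 = 0` is smooth if its equations `G e e'` in the four charts satisfy the
Jacobian criterion. -/
theorem smooth_closure (G : Fin 2 → Fin 2 → PlaneRing)
    (h : ∀ (e e' : Fin 2) (B : Type) [CommRing B] [Algebra ℚ B] (a b a' b' : B), CoordRel e a a' →
      CoordRel e' b b' →
        Associated (MvPolynomial.aeval ![a', b'] (G e e')) (MvPolynomial.aeval ![a, b] (G 0 0)))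
    (hr : ∀ e', ¬ r ∣ G 1 e') (ht : ∀ e, ¬ t ∣ G e 1)
    (hjac : ∀ e e', 1 ∈ Ideal.span
      {G e e', MvPolynomial.pderiv 0 (G e e'), MvPolynomial.pderiv 1 (G e e')}) :
    SmoothOfRelativeDimension 1 (closure.toSpec (Ideal.span {G 0 0})) := by
  set I := Ideal.span {G 0 0}
  refine smoothOfRelativeDimension_image (ι := Fin 2 × Fin 2) (affineCurve I) P1xP1.toSpec
    (fun _ => PlaneRing) (fun i => Overlap i.1 i.2 I) (fun i => planeChart i.1 i.2) ?_
    (fun i => overlapι i.1 i.2 I) (fun i => (changeCoord i.1 i.2 I).toRingHom)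
    ?_ ?_ ?_
  · intro x
    obtain ⟨e, he⟩ := exists_mem_range_linePt (pullback.fst P1.toSpec P1.toSpec x)
    obtain ⟨e', he'⟩ := exists_mem_range_linePt (pullback.snd P1.toSpec P1.toSpec x)
    exact ⟨(e, e'), (range_planeChart e e').ge ⟨he, he'⟩⟩
  · exact fun i => overlap_comp _ _ I
  · exact fun i => affineCurve_preimage _ _ I
  · rintro ⟨e, e'⟩
    dsimp only
    have hk : RingHom.ker (changeCoord e e' I).toRingHom = Ideal.span {G e e'} :=
      ker_changeCoord (h e e') (by rintro rfl; exact hr e') (by rintro rfl; exact ht e)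
    rw [hk, planeChart_toSpec, ← Spec.map_comp, ← CommRingCat.ofHom_comp,
      HasRingHomProperty.Spec_iff (P := @SmoothOfRelativeDimension 1)]
    exact locally_isStandardSmooth _ (hjac e e')

end

/-! ### Singular points over the algebraic closure -/

section

/-- The algebraic closure of `ℚ` over which singular points are looked for. -/
def K : Type := AlgebraicClosure ℚ

instance : Field K := inferInstanceAs (Field (AlgebraicClosure ℚ))

instance : Algebra ℚ K := inferInstanceAs (Algebra ℚ (AlgebraicClosure ℚ))

instance : IsAlgClosed K := inferInstanceAs (IsAlgClosed (AlgebraicClosure ℚ))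

instance : CharZero K := inferInstanceAs (CharZero (AlgebraicClosure ℚ))

/-- The tangent vector `a + α ε` at the point `a` of the affine line. -/
def tang (a α : K) : DualNumber K := TrivSqZeroExt.inl a + TrivSqZeroExt.inr α

theorem fst_tang (a α : K) : (tang a α).fst = a := by simp [tang]

theorem eq_tang (x : DualNumber K) : x = tang x.fst x.snd :=
    (TrivSqZeroExt.inl_fst_add_inr_snd_eq x).symm

/-- `(a, b)` is a singular point of the curve `G = 0`: the equation vanishes on all tangent vectors
at `(a, b)`. In this form the property is visibly preserved by coordinate changes. -/
def IsSing (G : PlaneRing) (a b : K) : Prop :=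
  ∀ α β, MvPolynomial.aeval ![tang a α, tang b β] G = 0

theorem IsSing.mul {G : PlaneRing} {a b : K} (h : IsSing G a b) (L : PlaneRing) :
    IsSing (L * G) a b := fun α β => by
  rw [map_mul, h α β, mul_zero]

theorem isUnit_dualNumber {x : DualNumber K} (h : x.fst ≠ 0) : IsUnit x := by
  rw [TrivSqZeroExt.isUnit_iff_isUnit_fst]
  exact h.isUnit

theorem IsSing.of_coordRel {G H : PlaneRing} {e e' : Fin 2}
    (h : ∀ (B : Type) [CommRing B] [Algebra ℚ B] (a b a' b' : B), CoordRel e a a' →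
      CoordRel e' b b' → Associated (MvPolynomial.aeval ![a', b'] H) (MvPolynomial.aeval ![a, b] G))
    {a b a' b' : K} (ha : CoordRel e a a') (hb : CoordRel e' b b') (hs : IsSing H a' b') :
    IsSing G a b := by
  have key : ∀ {e : Fin 2} {a a' : K} (_ : CoordRel e a a') (α : K),
      ∃ α', CoordRel e (tang a α) (tang a' α') := by
    intro e a a' h α
    have hu : IsUnit (den e (tang a α)) := by
      refine isUnit_dualNumber ?_
      have := h.isUnit_den.ne_zero
      unfold den at *
      split_ifs at * with he
      · simp
      · rwa [fst_tang]
    obtain ⟨y, hy⟩ := exists_coordRel hu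
    have h2 := hy.map (TrivSqZeroExt.fstHom ℚ K K)
    rw [TrivSqZeroExt.fstHom_apply, TrivSqZeroExt.fstHom_apply, fst_tang] at h2
    refine ⟨y.snd, ?_⟩
    rw [h.unique h2, ← eq_tang]
    exact hy
  intro α β
  obtain ⟨α', h1⟩ := key ha α
  obtain ⟨β', h2⟩ := key hb β
  exact (h _ _ _ _ _ h1 h2).eq_zero_iff.1 (hs α' β')

theorem aeval_tang (a b α β : K) (p : PlaneRing) :
    MvPolynomial.aeval ![tang a α, tang b β] p = tang (MvPolynomial.aeval ![a, b] p)
      (α * MvPolynomial.aeval ![a, b] (MvPolynomial.pderiv 0 p) +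
        β * MvPolynomial.aeval ![a, b] (MvPolynomial.pderiv 1 p)) := by
  induction p using MvPolynomial.induction_on with
  | C c =>
    simp only [MvPolynomial.aeval_C, MvPolynomial.pderiv_C, map_zero, mul_zero, add_zero]
    simp [tang, TrivSqZeroExt.algebraMap_eq_inl']
  | add p q hp hq =>
    rw [map_add, hp, hq]
    ext
    · simp [tang]
    · simp [tang]; ring
  | mul_X p i hp =>
    rw [map_mul, hp]
    fin_cases i
    · ext
      · simp [tang]
      · simp [tang]; ring
    · ext
      · simp [tang]
      · simp [tang]; ring

/-- By the Nullstellensatz, the Jacobian criterion can be tested on points. -/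
theorem one_mem_span_of_not_isSing {G : PlaneRing} (h : ∀ a b, ¬ IsSing G a b) :
    1 ∈ Ideal.span {G, MvPolynomial.pderiv 0 G, MvPolynomial.pderiv 1 G} := by
  by_contra hc
  obtain ⟨M, hM, hle⟩ := Ideal.exists_le_maximal _ (mt (Ideal.eq_top_iff_one _).1 hc)
  let : Field (PlaneRing ⧸ M) := Ideal.Quotient.field M
  have : Module.Finite ℚ (PlaneRing ⧸ M) := finite_of_finite_type_of_isJacobsonRing ℚ _
  let g : PlaneRing →ₐ[ℚ] K := (IsAlgClosed.lift (R := ℚ) (M := K) (S := PlaneRing ⧸ M)).comp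
    (Ideal.Quotient.mkₐ ℚ M)
  have hg : ∀ p ∈ Ideal.span {G, MvPolynomial.pderiv 0 G, MvPolynomial.pderiv 1 G}, g p = 0 := by
    intro p hp
    have : Ideal.Quotient.mkₐ ℚ M p = 0 := Ideal.Quotient.eq_zero_iff_mem.2 (hle hp)
    rw [AlgHom.comp_apply, this, map_zero]
  rw [aeval_coords g] at hg
  refine h (g r) (g t) fun α β => ?_
  rw [aeval_tang, hg _ (Ideal.subset_span (by simp)), hg _ (Ideal.subset_span (by simp)),
    hg _ (Ideal.subset_span (by simp))]
  simp [tang]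

/-- For two equations to agree up to a unit after a coordinate change in every algebra, it is enough
that they do in domains, as the generic case is the coordinate ring of the overlap of two planes. -/
theorem associated_of_isDomain {G H : PlaneRing} {e e' : Fin 2}
    (h : ∀ (B : Type) [CommRing B] [Algebra ℚ B] [IsDomain B] (a b a' b' : B), a ≠ b →
      CoordRel e a a' → CoordRel e' b b' →
        Associated (MvPolynomial.aeval ![a', b'] H) (MvPolynomial.aeval ![a, b] G))
    (B : Type) [CommRing B] [Algebra ℚ B] (a b a' b' : B) (ha : CoordRel e a a')
    (hb : CoordRel e' b b') :
    Associated (MvPolynomial.aeval ![a', b'] H) (MvPolynomial.aeval ![a, b] G) := by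
  have hX : ∀ i : Fin 2, (MvPolynomial.X i : PlaneRing) ≠ 0 := fun i => MvPolynomial.X_ne_zero i
  have hd : (den e r * den e' t : PlaneRing) ≠ 0 := by
    refine mul_ne_zero ?_ ?_
    · unfold den; split_ifs
      exacts [one_ne_zero, hX 0]
    · unfold den; split_ifs
      exacts [one_ne_zero, hX 1]
  have hinj : ∀ p, toOverlap e e' ⊥ p = 0 → p = 0 := by
    intro p h
    rw [toOverlap_apply, IsLocalization.map_eq_zero_iff (Submonoid.powers
      (Ideal.Quotient.mk ⊥ (den e r * den e' t)))] at h
    obtain ⟨⟨_, n, rfl⟩, h⟩ := h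
    simp only [← map_pow, ← map_mul, Ideal.Quotient.eq_zero_iff_mem, Ideal.mem_bot] at h
    exact (mul_eq_zero.1 h).resolve_left (pow_ne_zero n hd)
  have : IsDomain (Overlap e e' ⊥) := IsLocalization.isDomain_localization (by
    rintro _ ⟨n, rfl⟩
    refine mem_nonZeroDivisors_of_ne_zero ?_
    simp only [← map_pow]
    rw [Ne, Ideal.Quotient.eq_zero_iff_mem, Ideal.mem_bot]
    exact pow_ne_zero n hd)
  have h0 := h (Overlap e e' ⊥) (toOverlap e e' ⊥ r) (toOverlap e e' ⊥ t) _ _ ?_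
    (coordRel_overlapFst e e' ⊥) (coordRel_overlapSnd e e' ⊥)
  · obtain ⟨θ, hθ, hc⟩ := exists_overlap_lift (e := e) (e' := e') (I := ⊥)
      (MvPolynomial.aeval ![a, b]) (fun p hp => by rw [Ideal.mem_bot.1 hp, map_zero])
      (a := a') (b := b') (by simpa [r]) (by simpa [t])
    rw [← aeval_coords] at h0
    have := h0.map θ
    rwa [hθ, ← AlgHom.comp_apply θ, ← changeCoord, hc] at this
  · intro h1
    have := congrArg (MvPolynomial.eval ![0, 1]) (hinj (r - t) (by rw [map_sub, h1, sub_self]))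
    simp [r, t] at this

theorem exists_coordRel_symm (e : Fin 2) (a : K) : (e = 1 ∧ a = 0) ∨ ∃ a', CoordRel e a' a := by
  by_cases h : e = 1 ∧ a = 0
  · exact .inl h
  · right
    have : IsUnit (den e a) := by
      unfold den
      split_ifs with he
      · exact isUnit_one
      · exact IsUnit.mk0 _ fun ha => h ⟨by omega, ha⟩
    obtain ⟨a', h⟩ := exists_coordRel this
    exact ⟨a', h.symm⟩

/-- The closure of `G 0 0 = 0`, with equations `G e e'` in the four charts, is smooth if there are
no singular points in the affine plane and at infinity. -/
theorem smooth_closure_of_not_isSing (G : Fin 2 → Fin 2 → PlaneRing)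
    (h : ∀ (e e' : Fin 2) (B : Type) [CommRing B] [Algebra ℚ B] [IsDomain B] (a b a' b' : B),
      a ≠ b → CoordRel e a a' → CoordRel e' b b' →
        Associated (MvPolynomial.aeval ![a', b'] (G e e')) (MvPolynomial.aeval ![a, b] (G 0 0)))
    (hr : ∀ e', ¬ r ∣ G 1 e') (ht : ∀ e, ¬ t ∣ G e 1)
    (hs : ∀ a b, ¬ IsSing (G 0 0) a b) (hs0 : ∀ e' b, ¬ IsSing (G 1 e') 0 b)
    (hs1 : ∀ e a, ¬ IsSing (G e 1) a 0) :
    SmoothOfRelativeDimension 1 (closure.toSpec (Ideal.span {G 0 0})) := by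
  have hG := fun e e' => associated_of_isDomain (h e e')
  refine smooth_closure G hG hr ht fun e e' => ?_
  refine one_mem_span_of_not_isSing fun a b hab => ?_
  rcases exists_coordRel_symm e a with ⟨rfl, rfl⟩ | ⟨a', ha'⟩
  · exact hs0 e' b hab
  rcases exists_coordRel_symm e' b with ⟨rfl, rfl⟩ | ⟨b', hb'⟩
  · exact hs1 e a hab
  exact hs a' b' (hab.of_coordRel (hG e e') ha' hb')

end

/-! ### Identities for `f`, `g` and the Wronskian -/

section

open Polynomial

theorem f_add_one (j : ℤ) : f (j + 1) = X * f j - f (j - 1) := by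
  linear_combination f_recurrence j

theorem f_sub_one (j : ℤ) : f (j - 1) = X * f j - f (j + 1) := by
  linear_combination f_recurrence j

theorem two_step_induction {P : ℤ → Prop} (h0 : P 0) (h1 : P 1)
    (hs : ∀ n, P (n - 1) → P n → P (n + 1)) (hp : ∀ n, P (n + 1) → P n → P (n - 1)) (n : ℤ) :
    P n := by
  induction n using Chebyshev.induct with
  | zero => exact h0
  | one => exact h1
  | add_two n h2 h1 =>
    have := hs (n + 1) (by simpa using h1) h2
    rwa [add_assoc] at this
  | neg_add_one n h1 h2 => exact hp _ h2 h1

/-- The addition formula. -/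
theorem f_add (m n : ℤ) : f (m + n) = f m * f (n + 1) - f (m - 1) * f n := by
  induction n using two_step_induction with
  | h0 => simp [f_zero, f_one]
  | h1 =>
    have h2 : f (1 + 1) = X := by rw [f_add_one]; simp [f_zero, f_one]
    rw [h2, f_add_one, f_one]; ring
  | hs n h1 h2 =>
    rw [show m + (n + 1) = m + n + 1 by ring, f_add_one (m + n), h2,
      show m + n - 1 = m + (n - 1) by ring, h1, f_add_one (n + 1), f_add_one n]
    ring_nf
  | hp n h1 h2 =>
    rw [show m + (n - 1) = m + n - 1 by ring, f_sub_one (m + n), h2,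
      show m + n + 1 = m + (n + 1) by ring, h1, f_sub_one n, f_add_one (n + 1),
      sub_add_cancel, f_add_one n, add_sub_cancel_right]
    ring_nf

theorem f_norm (m : ℤ) : f m ^ 2 - X * f m * f (m - 1) + f (m - 1) ^ 2 = 1 := by
  have h := Chebyshev.S_sq_add_S_sq ℤ (m - 1 - 1)
  rw [sub_add_cancel] at h
  unfold f
  linear_combination h

theorem f_two_mul (m : ℤ) : f (2 * m) = f m * (X * f m - 2 * f (m - 1)) := by
  rw [two_mul, f_add, f_add_one]; ring

theorem f_two_mul_sub_one (m : ℤ) : f (2 * m - 1) = f m ^ 2 - f (m - 1) ^ 2 := by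
  rw [show 2 * m - 1 = m + (m - 1) by ring, f_add]
  ring_nf

theorem f_neg (j : ℤ) : f (-j) = -f j := by
  unfold f
  rw [Chebyshev.S_neg_sub_one]

/-- The substitution `X = Y + Y⁻¹` shows that `f_{2m}` is `X` times `f_m` at `Y² + Y⁻² = X² - 2`. -/
theorem f_two_mul_comp (m : ℤ) : f (2 * m) = X * (f m).comp (X ^ 2 - 2) := by
  induction m using two_step_induction with
  | h0 => simp [f_zero]
  | h1 => rw [f_two_mul]; simp [f_zero, f_one]
  | hs n h1 h2 =>
    rw [f_add_one n, sub_comp, mul_comp, X_comp, mul_sub, ← h1]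
    rw [show X * ((X ^ 2 - 2) * (f n).comp (X ^ 2 - 2)) = (X ^ 2 - 2) * (f (2 * n) : ℤ[X]) by
      rw [h2]; ring, show 2 * (n + 1) = 2 * n + 1 + 1 by ring, f_add_one (2 * n + 1),
      add_sub_cancel_right, f_add_one, show 2 * (n - 1) = 2 * n - 1 - 1 by ring,
      f_sub_one (2 * n - 1), sub_add_cancel]
    ring
  | hp n h1 h2 =>
    rw [f_sub_one n, sub_comp, mul_comp, X_comp, mul_sub X, ← h1]
    rw [show X * ((X ^ 2 - 2) * (f n).comp (X ^ 2 - 2)) = (X ^ 2 - 2) * (f (2 * n) : ℤ[X]) by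
      rw [h2]; ring, show 2 * (n - 1) = 2 * n - 1 - 1 by ring, f_sub_one (2 * n - 1),
      sub_add_cancel, f_sub_one (2 * n), show 2 * (n + 1) = 2 * n + 1 + 1 by ring,
      f_add_one (2 * n + 1), add_sub_cancel_right]
    ring

theorem f_eval_two (j : ℤ) : (f j).eval 2 = j := by
  simp [f, Chebyshev.S_eval_two]

/-- The derivative of `f_j`, with `X f_j - 2 f_{j-1} = f_{j+1} - f_{j-1}`. -/
theorem derivative_f (j : ℤ) :
    (X ^ 2 - 4) * derivative (f j) = (j : ℤ[X]) * (X * f j - 2 * f (j - 1)) - X * f j := by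
  induction j using two_step_induction with
  | h0 => simp [f_zero]
  | h1 => simp [f_zero, f_one]
  | hs n h1 h2 =>
    rw [f_add_one n, derivative_sub, derivative_mul, derivative_X, add_sub_cancel_right]
    rw [f_sub_one (n - 1), sub_add_cancel] at h1
    push_cast at *
    linear_combination X * h2 - h1
  | hp n h1 h2 =>
    rw [add_sub_cancel_right] at h1
    have h3 : derivative (f (n - 1)) = f n + X * derivative (f n) - derivative (f (n + 1)) := by
      rw [f_sub_one n, derivative_sub, derivative_mul, derivative_X]; ring
    have h4 : f (n - 1 - 1) = X * f (n - 1) - f n := by rw [f_sub_one (n - 1), sub_add_cancel]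
    have h5 := f_add_one n
    rw [h3, h4]
    push_cast at *
    rw [h5] at h1 ⊢
    linear_combination X * h2 - h1

/-- The Wronskian of `Φ_{k-1}` and `Φ_{k+1}`, i.e. the numerator of the derivative of
`Φ_{k+1} / Φ_{k-1}`. -/
def wr (k : ℤ) : ℤ[X] := wronskian (Phi (k - 1)) (Phi (k + 1))

theorem X_sub_two_ne : (X - 2 : ℤ[X]) ≠ 0 := X_sub_C_ne_zero 2

theorem g_add_one (m : ℤ) : g (m + 1) = (X - 1) * f m - f (m - 1) := by
  rw [g, f_add_one, add_sub_cancel_right]; ring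

theorem wr_two_mul (m : ℤ) : (X + 2) * wr (2 * m) = f (2 * m) + 2 * (m : ℤ[X]) := by
  rw [wr, Phi_odd, show 2 * m + 1 = 2 * (m + 1) - 1 by ring, Phi_odd, wronskian,
    g_add_one, g, f_two_mul]
  refine mul_left_cancel₀ X_sub_two_ne ?_
  have h1 := derivative_f m
  have h2 := derivative_f (m - 1)
  have h3 := f_norm m
  rw [f_sub_one (m - 1), sub_add_cancel] at h2
  simp only [derivative_sub, derivative_mul, derivative_X, derivative_one]
  push_cast at *
  linear_combination (2 - X) * f (m - 1) * h1 + (X - 2) * f m * h2 +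
    (2 * (m : ℤ[X]) * (X - 2)) * h3

theorem wr_two_mul_sub_one (m : ℤ) :
    (X ^ 2 - 4) * wr (2 * m - 1) = f (2 * m - 1) - (2 * (m : ℤ[X]) - 1) := by
  rw [wr, show 2 * m - 1 - 1 = 2 * (m - 1) by ring, Phi_even, sub_add_cancel, Phi_even, wronskian,
    f_two_mul_sub_one]
  have h1 := derivative_f m
  have h2 := derivative_f (m - 1)
  have h3 := f_norm m
  rw [f_sub_one (m - 1), sub_add_cancel] at h2
  push_cast at *
  linear_combination f (m - 1) * h1 - f m * h2 + (-(2 * (m : ℤ[X]) - 1)) * h3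

end

/-! ### Degrees, special values and integrality -/

section

open Polynomial

theorem f_monic (n : ℕ) : (f (n + 1)).Monic ∧ (f (n + 1)).natDegree = n := by
  induction n using Nat.twoStepInduction with
  | zero => simp [f_one]
  | one =>
    have : f (1 + 1) = X := by rw [f_add_one]; simp [f_zero, f_one]
    norm_num at this ⊢
    simp [this]
  | more n h1 h2 =>
    have e : f ((n + 2 : ℕ) + 1) = X * f ((n + 1 : ℕ) + 1) - f (n + 1) := by
      rw [f_add_one]; push_cast; ring_nf
    have hm : (X * f ((n + 1 : ℕ) + 1)).Monic := monic_X.mul h2.1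
    have hd : (X * f ((n + 1 : ℕ) + 1)).natDegree = n + 2 := by
      rw [monic_X.natDegree_mul h2.1, natDegree_X, h2.2]; ring
    have hlt : (f (n + 1)).natDegree < (X * f ((n + 1 : ℕ) + 1)).natDegree := by
      rw [hd, h1.2]; omega
    rw [e]
    exact ⟨hm.sub_of_left (degree_lt_degree hlt), by rw [natDegree_sub_eq_left_of_natDegree_lt hlt,
        hd]⟩

theorem g_monic (n : ℕ) : (g (n + 1)).Monic ∧ (g (n + 1)).natDegree = n := by
  rw [g, add_sub_cancel_right]
  cases n with
  | zero => simp [f_one, f_zero]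
  | succ n =>
    have h1 := f_monic n
    have h2 := f_monic (n + 1)
    have hlt : (f (n + 1 : ℕ)).natDegree < (f ((n + 1 : ℕ) + 1)).natDegree := by
      rw [h2.2, Nat.cast_succ, h1.2]; omega
    exact ⟨h2.1.sub_of_left (degree_lt_degree hlt),
      by rw [natDegree_sub_eq_left_of_natDegree_lt hlt, h2.2]⟩

theorem Phi_monic (n : ℕ) : (Phi (n + 1)).Monic ∧ (Phi (n + 1)).natDegree = n / 2 := by
  obtain ⟨j, rfl | rfl⟩ := Nat.even_or_odd' n
  · have := g_monic j
    rw [show ((2 * j : ℕ) : ℤ) + 1 = 2 * (j + 1) - 1 by push_cast; ring, Phi_odd]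
    exact ⟨this.1, by rw [this.2]; omega⟩
  · have := f_monic j
    rw [show ((2 * j + 1 : ℕ) : ℤ) + 1 = 2 * (j + 1) by push_cast; ring, Phi_even]
    exact ⟨this.1, by rw [this.2]; omega⟩

theorem Phi_neg (k : ℤ) : Phi (-k) = Phi k ∨ Phi (-k) = -Phi k := by
  obtain ⟨j, rfl | rfl⟩ := Int.even_or_odd' k
  · right
    rw [show -(2 * j) = 2 * (-j) by ring, Phi_even, Phi_even, f_neg]
  · left
    rw [show -(2 * j + 1) = 2 * (-j) - 1 by ring, Phi_odd,
      show 2 * j + 1 = 2 * (j + 1) - 1 by ring, Phi_odd, g, g, f_neg,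
      show -j - 1 = -(j + 1) by ring, f_neg, add_sub_cancel_right]
    ring

theorem Phi_leadingCoeff {k : ℤ} (hk : k ≠ 0) :
    IsUnit (Phi k).leadingCoeff ∧ (Phi k).natDegree = (k.natAbs - 1) / 2 := by
  have key : ∀ n : ℕ, 0 < n → IsUnit (Phi n).leadingCoeff ∧ (Phi n).natDegree = (n - 1) / 2 := by
    intro n hn
    obtain ⟨n, rfl⟩ := Nat.exists_eq_succ_of_ne_zero hn.ne'
    have := Phi_monic n
    rw [Nat.succ_eq_add_one, Nat.cast_succ, this.1.leadingCoeff, this.2]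
    exact ⟨isUnit_one, by omega⟩
  have h := key k.natAbs (by omega)
  rcases Int.natAbs_eq k with hk | hk
  · rw [← hk] at h; exact h
  · rw [show (k.natAbs : ℤ) = -k by omega] at h
    rcases Phi_neg k with h2 | h2
    · rwa [h2] at h
    · rwa [h2, leadingCoeff_neg, IsUnit.neg_iff, natDegree_neg] at h

variable {R : Type} [CommRing R]

/-- The polynomials `f_j` are monic up to sign, so their values determine integral elements. -/
theorem isIntegral_of_aeval_f {j : ℤ} (hj : 2 ≤ |j|) {x : R} {c : ℤ} (h : aeval x (f j) = c) :
    IsIntegral ℤ x := by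
  have key : ∀ (n : ℕ) (c : ℤ), aeval x (f (n + 2)) = c → IsIntegral ℤ x := by
    intro n c h
    have hm := f_monic (n + 1)
    push_cast at hm
    rw [add_assoc, show (1 : ℤ) + 1 = 2 by norm_num] at hm
    refine ⟨f (n + 2) - C c, hm.1.sub_of_left ?_, ?_⟩
    · refine degree_C_le.trans_lt ?_
      rw [← natDegree_pos_iff_degree_pos, hm.2]
      omega
    · rw [← aeval_def, map_sub, h, aeval_C]
      simp
  rcases le_abs.1 hj with hj | hj
  · obtain ⟨n, hn⟩ := Int.eq_ofNat_of_zero_le (sub_nonneg.2 hj)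
    exact key n c (by rw [← hn, sub_add_cancel, h])
  · obtain ⟨n, hn⟩ := Int.eq_ofNat_of_zero_le (sub_nonneg.2 hj)
    refine key n (-c) ?_
    rw [← hn, sub_add_cancel, f_neg, map_neg, h]
    simp

theorem derivative_f_eval_neg_two (j : ℤ) :
    (f j).eval (-2) = -(j.negOnePow * j) ∧
      6 * (derivative (f j)).eval (-2) = j.negOnePow * (j ^ 3 - j) := by
  induction j using two_step_induction with
  | h0 => simp [f_zero]
  | h1 => simp [f_one]
  | hs n h1 h2 =>
    rw [f_add_one n]
    simp only [derivative_sub, derivative_mul, derivative_X, eval_sub, eval_mul, eval_add, eval_X,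
      one_mul]
    rw [Int.negOnePow_sub] at h1
    rw [Int.negOnePow_add]
    simp only [Int.negOnePow_one, Units.val_mul, Units.val_neg, Units.val_one] at *
    exact ⟨by linear_combination -2 * h2.1 - h1.1,
      by linear_combination 6 * h2.1 - 2 * h2.2 - h1.2⟩
  | hp n h1 h2 =>
    rw [f_sub_one n]
    simp only [derivative_sub, derivative_mul, derivative_X, eval_sub, eval_mul, eval_add, eval_X,
      one_mul]
    rw [Int.negOnePow_add] at h1
    rw [Int.negOnePow_sub]
    simp only [Int.negOnePow_one, Units.val_mul, Units.val_neg, Units.val_one] at *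
    exact ⟨by linear_combination -2 * h2.1 - h1.1,
      by linear_combination 6 * h2.1 - 2 * h2.2 - h1.2⟩

/-- The value at `-2` is that of the derivative of `f_{2m}`, by differentiation of
`(X + 2) W = f_{2m} + 2m`. -/
theorem wr_eval_neg_two {m : ℤ} (hm : m ≠ 0) : (wr (2 * m)).eval (-2) ≠ 0 := by
  have h := congrArg (fun p => (derivative p).eval (-2)) (wr_two_mul m)
  have h2 := (derivative_f_eval_neg_two (2 * m)).2
  have h3 : (2 * m).negOnePow = 1 := Int.negOnePow_even _ (even_two_mul m)
  simp [derivative_mul] at h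
  rw [h3] at h2
  intro h0
  rw [← h, h0] at h2
  have : (2 * m) * ((2 * m - 1) * (2 * m + 1)) = 0 := by
    push_cast at h2
    linear_combination -h2
  have h4 : (2 * m - 1) ≠ 0 := by omega
  have h5 : (2 * m + 1) ≠ 0 := by omega
  simp [hm, h4, h5] at this

theorem aeval_f_norm (m : ℤ) (x : R) :
    aeval x (f m) ^ 2 - x * aeval x (f m) * aeval x (f (m - 1)) + aeval x (f (m - 1)) ^ 2 = 1 := by
  simpa using congrArg (aeval x) (f_norm m)

theorem aeval_f_two_mul (m : ℤ) (x : R) :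
    aeval x (f (2 * m)) = aeval x (f m) * (x * aeval x (f m) - 2 * aeval x (f (m - 1))) := by
  simpa [map_ofNat] using congrArg (aeval x) (f_two_mul m)

theorem aeval_g (m : ℤ) (x : R) : aeval x (g m) = aeval x (f m) - aeval x (f (m - 1)) := by
  simp [g]

theorem aeval_g_add_one (m : ℤ) (x : R) :
    aeval x (g (m + 1)) = (x - 1) * aeval x (f m) - aeval x (f (m - 1)) := by
  simp [g_add_one]

theorem g_norm (m : ℤ) (x : R) : aeval x (g m) ^ 2 - x * aeval x (g m) * aeval x (g (m + 1)) +
    aeval x (g (m + 1)) ^ 2 = 2 - x := by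
  rw [aeval_g, aeval_g_add_one]
  linear_combination (2 - x) * aeval_f_norm m x

theorem g_sq_sub_sq (m : ℤ) (x : R) :
    aeval x (g (m + 1)) ^ 2 - aeval x (g m) ^ 2 = (x - 2) * aeval x (f (2 * m)) := by
  rw [aeval_g_add_one, aeval_g, aeval_f_two_mul]
  ring

/-- `Φ_{k-1}` and `Φ_{k+1}` have no common zero, in any nonzero ring. -/
theorem Phi_pair_ne_zero [Nontrivial R] (k : ℤ) (x : R) :
    ¬ (aeval x (Phi (k - 1)) = 0 ∧ aeval x (Phi (k + 1)) = 0) := by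
  rintro ⟨h1, h2⟩
  obtain ⟨j, rfl | rfl⟩ := Int.even_or_odd' k
  · rw [Phi_odd, aeval_g] at h1
    rw [show 2 * j + 1 = 2 * (j + 1) - 1 by ring, Phi_odd, aeval_g_add_one] at h2
    have := aeval_f_norm j x
    exact one_ne_zero (α := R) (by
      linear_combination -this + aeval x (f j) * h1 - aeval x (f (j - 1)) * h2)
  · rw [add_sub_cancel_right, Phi_even] at h1
    rw [show 2 * j + 1 + 1 = 2 * (j + 1) by ring, Phi_even] at h2
    have := aeval_f_norm (j + 1) x
    rw [add_sub_cancel_right, h1, h2] at this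
    simp at this

end

/-! ### Valuations above `2` -/

section

open Polynomial

theorem sub_dvd_aeval_sub {B : Type} [CommRing B] (x y : B) (p : ℤ[X]) :
    x - y ∣ aeval x p - aeval y p := by
  have := sub_dvd_eval_sub x y (p.map (algebraMap ℤ B))
  rwa [eval_map_algebraMap, eval_map_algebraMap] at this

variable {F Γ : Type} [Field F] [LinearOrderedCommGroupWithZero Γ] (v : Valuation F Γ)

theorem valuation_intCast_le_one (n : ℤ) : v n ≤ 1 :=
  (v.mem_integer_iff _).1 (intCast_mem v.integer n)

theorem valuation_aeval_le_one {x : F} (hx : v x ≤ 1) (p : ℤ[X]) : v (aeval x p) ≤ 1 := by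
  have := aeval_algebraMap_apply F (⟨x, hx⟩ : v.integer) p
  rw [show algebraMap v.integer F ⟨x, hx⟩ = x from rfl] at this
  rw [this]
  exact (aeval (⟨x, hx⟩ : v.integer) p).2

theorem exists_aeval_sub {x y : F} (hx : v x ≤ 1) (hy : v y ≤ 1) (p : ℤ[X]) :
    ∃ z, v z ≤ 1 ∧ aeval x p = aeval y p + (x - y) * z := by
  have hx' := aeval_algebraMap_apply F (⟨x, hx⟩ : v.integer) p
  have hy' := aeval_algebraMap_apply F (⟨y, hy⟩ : v.integer) p
  rw [show algebraMap v.integer F ⟨x, hx⟩ = x from rfl] at hx'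
  rw [show algebraMap v.integer F ⟨y, hy⟩ = y from rfl] at hy'
  obtain ⟨z, hz⟩ := sub_dvd_aeval_sub (⟨x, hx⟩ : v.integer) ⟨y, hy⟩ p
  refine ⟨z, z.2, ?_⟩
  have := congrArg (algebraMap v.integer F) hz
  rw [map_sub, ← hx', ← hy', map_mul] at this
  exact (sub_eq_iff_eq_add'.1 this)

theorem valuation_le_one_of_isIntegral {x : F} (hx : IsIntegral ℤ x) : v x ≤ 1 :=
  Valuation.Integers.mem_of_integral (Valuation.integer.integers v) (hx.tower_top)

variable {v}

/-- A root of a quadratic polynomial with unit leading and constant coefficients is a unit. -/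
theorem valuation_eq_one_of_quadratic {a b d x : F} (ha : v a = 1) (hb : v b ≤ 1) (hd : v d = 1)
    (h : a * x ^ 2 + b * x + d = 0) : v x = 1 := by
  rcases lt_trichotomy (v x) 1 with hx | hx | hx
  · have h1 : v d < 1 := by
      rw [show d = -(x * (a * x + b)) by linear_combination h, v.map_neg, v.map_mul]
      refine mul_lt_one_of_lt_of_le hx (v.map_add_le ?_ hb)
      rw [v.map_mul, ha, one_mul]
      exact hx.le
    exact absurd hd h1.ne
  · exact hx
  · have h0 : x ≠ 0 := by rintro rfl; simp at hx
    have hi : v x⁻¹ < 1 := by rw [map_inv₀]; exact inv_lt_one_of_one_lt₀ hx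
    have h1 : v a < 1 := by
      rw [show a = -(x⁻¹ * (b + d * x⁻¹)) by field_simp; linear_combination h, v.map_neg, v.map_mul]
      refine mul_lt_one_of_lt_of_le hi (v.map_add_le hb ?_)
      rw [v.map_mul, hd, one_mul]
      exact hi.le
    exact absurd ha h1.ne

theorem valuation_odd (h2 : v 2 < 1) {n : ℤ} (hn : Odd n) : v n = 1 := by
  obtain ⟨j, rfl⟩ := hn
  push_cast
  rw [add_comm]
  refine v.map_one_add_of_lt ?_
  rw [v.map_mul]
  exact mul_lt_one_of_lt_of_le h2 (valuation_intCast_le_one v j)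

theorem valuation_mul_sub_one {u w : F} {ρ : Γ} (hu : v u ≤ 1) (h : v (u - 1) ≤ ρ)
    (h' : v (w - 1) ≤ ρ) : v (u * w - 1) ≤ ρ := by
  rw [show u * w - 1 = u * (w - 1) + (u - 1) by ring]
  refine v.map_add_le ?_ h
  rw [v.map_mul]
  exact (mul_le_of_le_one_left' hu).trans h'

theorem valuation_inv_sub_one {u : F} (hu : v u = 1) : v (u⁻¹ - 1) = v (u - 1) := by
  have h0 : u ≠ 0 := by rintro rfl; simp at hu
  rw [show u⁻¹ - 1 = -(u⁻¹ * (u - 1)) by field_simp; ring, v.map_neg, v.map_mul, map_inv₀, hu,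
    inv_one, one_mul]

theorem valuation_pow_sub_one_le {u : F} (hu : v u = 1) (n : ℕ) : v (u ^ n - 1) ≤ v (u - 1) := by
  induction n with
  | zero => simp
  | succ n ih =>
    rw [pow_succ]
    exact valuation_mul_sub_one (by rw [v.map_pow, hu, one_pow]) ih le_rfl

theorem valuation_zpow_sub_one_le {u : F} (hu : v u = 1) (n : ℤ) :
    v (u ^ n - 1) ≤ v (u - 1) := by
  obtain ⟨n, rfl | rfl⟩ := n.eq_nat_or_neg
  · rw [zpow_natCast]; exact valuation_pow_sub_one_le hu n
  · rw [zpow_neg, zpow_natCast, valuation_inv_sub_one (by rw [v.map_pow, hu, one_pow])]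
    exact valuation_pow_sub_one_le hu n

theorem valuation_eq_one_of_sub_lt {u : F} (h : v (u - 1) < 1) : v u = 1 := by
  rw [show u = 1 + (u - 1) by ring]
  exact v.map_one_add_of_lt h

/-- Raising to an odd power does not change the distance to `1`. -/
theorem valuation_zpow_sub_one_of_odd (h2 : v 2 < 1) {u : F} (hu : v (u - 1) < 1) {n : ℤ}
    (hn : Odd n) : v (u ^ n - 1) = v (u - 1) := by
  have h1 := valuation_eq_one_of_sub_lt hu
  have key : ∀ n : ℕ, Odd n → v (u ^ n - 1) = v (u - 1) := by
    intro n hn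
    rw [← geom_sum_mul, v.map_mul]
    have h3 : v (∑ i ∈ Finset.range n, u ^ i - n) < 1 := by
      rw [show (n : F) = ∑ i ∈ Finset.range n, (1 : F) by simp, ← Finset.sum_sub_distrib]
      exact v.map_sum_lt one_ne_zero fun i _ => (valuation_pow_sub_one_le h1 i).trans_lt hu
    have h4 : v (n : F) = 1 := by
      have := valuation_odd h2 (n := n) (by exact_mod_cast hn)
      exact_mod_cast this
    have h5 : v (∑ i ∈ Finset.range n, u ^ i) = 1 := by
      rw [show ∑ i ∈ Finset.range n, u ^ i = (∑ i ∈ Finset.range n, u ^ i - n) + n by ring,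
        v.map_add_eq_of_lt_right (by rwa [h4]), h4]
    rw [h5, one_mul]
  obtain ⟨n, rfl | rfl⟩ := n.eq_nat_or_neg
  · rw [zpow_natCast]; exact key n (by exact_mod_cast hn)
  · rw [zpow_neg, zpow_natCast, valuation_inv_sub_one (by rw [v.map_pow, h1, one_pow])]
    exact key n (by exact_mod_cast (Int.neg_neg (n : ℤ) ▸ hn.neg : Odd (n : ℤ)))

/-- Squaring multiplies the distance to `1` by exactly `v 2`, if this distance is less than
`v 2`. -/
theorem valuation_sq_sub_one {u : F} (hu : v (u - 1) < v 2) :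
    v (u ^ 2 - 1) = v 2 * v (u - 1) := by
  rw [show u ^ 2 - 1 = ((u - 1) + 2) * (u - 1) by ring, v.map_mul, v.map_add_eq_of_lt_right hu]

theorem valuation_sq_sub_one_le {u : F} (hu : v (u - 1) ≤ v 2) :
    v (u ^ 2 - 1) ≤ v 2 * v (u - 1) := by
  rw [show u ^ 2 - 1 = ((u - 1) + 2) * (u - 1) by ring, v.map_mul]
  exact mul_le_mul_left (v.map_add_le hu le_rfl) _

theorem valuation_pow_two_pow_sub_one (h2 : v 2 < 1) {u : F} (hu : v (u - 1) < v 2) (j : ℕ) :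
    v (u ^ 2 ^ j - 1) = v 2 ^ j * v (u - 1) := by
  induction j with
  | zero => simp
  | succ j ih =>
    rw [pow_succ, pow_mul, valuation_sq_sub_one, ih, pow_succ', mul_assoc]
    rw [ih]
    exact (mul_le_of_le_one_left' (pow_le_one' h2.le j)).trans_lt hu

theorem valuation_pow_two_pow_sub_one_le (h2 : v 2 < 1) {u : F} (hu : v (u - 1) ≤ v 2) (j : ℕ) :
    v (u ^ 2 ^ j - 1) ≤ v 2 ^ j * v (u - 1) := by
  induction j with
  | zero => simp
  | succ j ih =>
    rw [pow_succ 2, pow_mul, pow_succ' (v 2), mul_assoc]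
    refine (valuation_sq_sub_one_le ?_).trans (mul_le_mul_right ih _)
    exact ih.trans ((mul_le_of_le_one_left' (pow_le_one' h2.le j)).trans hu)

theorem exists_two_pow_mul {n : ℤ} (hn : n ≠ 0) : ∃ (a : ℕ) (m : ℤ), Odd m ∧ n = 2 ^ a * m := by
  obtain ⟨a, m, hm, h⟩ := Nat.exists_eq_two_pow_mul_odd (Int.natAbs_ne_zero.2 hn)
  rcases Int.natAbs_eq n with h' | h'
  · exact ⟨a, m, by exact_mod_cast hm, by rw [h', h]; push_cast; ring⟩
  · exact ⟨a, -m, by exact (show Odd (m : ℤ) by exact_mod_cast hm).neg,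
      by rw [h', h]; push_cast; ring⟩

/-- At a point `2 + 2s`, the value of `f_N` is `N` up to a factor congruent to `1` modulo `s`. For
odd `N` this is a congruence with `f_N(2) = N`, and `f_{2N} = f_N (X f_N - 2 f_{N-1})` allows an
induction. -/
theorem exists_aeval_f_near_two (h2 : v 2 < 1) {s : F} (hs : v s ≤ 1) {N : ℤ} (hN : N ≠ 0) :
    ∃ z, v z ≤ 1 ∧ aeval (2 + 2 * s) (f N) = N * (1 + s * z) := by
  have hv2 : v (2 + 2 * s) ≤ 1 := by
    refine v.map_add_le h2.le ?_
    rw [v.map_mul]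
    exact mul_le_one' h2.le hs
  have key : ∀ p : ℤ[X], ∃ z, v z ≤ 1 ∧ aeval (2 + 2 * s) p = (p.eval 2 : ℤ) + 2 * s * z := by
    intro p
    obtain ⟨z, hz, h⟩ := exists_aeval_sub v hv2 h2.le p
    refine ⟨z, hz, ?_⟩
    rw [h, show (2 : F) = algebraMap ℤ F 2 by simp, aeval_algebraMap_apply_eq_algebraMap_eval]
    simp
  obtain ⟨a, m, hm, rfl⟩ := exists_two_pow_mul hN
  clear hN
  induction a with
  | zero =>
    obtain ⟨z, hz, h⟩ := key (f m)
    have hm1 := valuation_odd h2 hm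
    have hm0 : (m : F) ≠ 0 := by intro h; rw [h] at hm1; simp at hm1
    refine ⟨2 * z / m, ?_, ?_⟩
    · rw [map_div₀, hm1, div_one, v.map_mul]
      exact mul_le_one' h2.le hz
    · rw [pow_zero, one_mul, h, f_eval_two]
      field_simp
  | succ a ih =>
    obtain ⟨z, hz, h⟩ := ih
    obtain ⟨z', hz', h'⟩ := key (X * f (2 ^ a * m) - 2 * f (2 ^ a * m - 1))
    simp only [eval_sub, eval_mul, eval_X, f_eval_two, eval_ofNat, map_sub, map_mul, aeval_X,
      map_ofNat] at h'
    refine ⟨z + z' + s * z * z', ?_, ?_⟩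
    · refine v.map_add_le (v.map_add_le hz hz') ?_
      rw [v.map_mul, v.map_mul]
      exact mul_le_one' (mul_le_one' hs hz) hz'
    · rw [pow_succ', mul_assoc, aeval_f_two_mul, h', h]
      push_cast
      ring

/-- If `t² - 4` is divisible by more than `2`, then `f_{2n}(t) = -2n` forces `t = -2`: writing
`f_{2n}(t) = t f_n(t² - 2)`, the equation becomes `t ≈ -2` with an error that is a small multiple of
`t + 2` itself. -/
theorem eq_neg_two_of_valuation_lt [CharZero F] (h2 : v 2 < 1) {n : ℤ} (hn : n ≠ 0) {t : F}
    (ht : aeval t (f (2 * n)) = -(2 * n : ℤ)) (hlt : v (t ^ 2 - 4) < v 2) : t = -2 := by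
  have hπ : v 2 ≠ 0 := (v.ne_zero_iff).2 two_ne_zero
  have hn0 : (n : F) ≠ 0 := Int.cast_ne_zero.2 hn
  obtain ⟨s, hs⟩ : ∃ s, t ^ 2 - 4 = 2 * s := ⟨(t ^ 2 - 4) / 2, by field_simp⟩
  have hs1 : v s < 1 := by
    rw [hs, v.map_mul] at hlt
    exact (mul_lt_iff_lt_one_right (zero_lt_iff.2 hπ)).1 hlt
  obtain ⟨z, hz, h⟩ := exists_aeval_f_near_two h2 hs1.le hn
  rw [f_two_mul_comp, map_mul, aeval_X, aeval_comp] at ht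
  have e : aeval t (X ^ 2 - 2 : ℤ[X]) = 2 + 2 * s := by
    simp [map_ofNat]; linear_combination hs
  rw [e, h] at ht
  push_cast at ht
  have h1 : t * (1 + s * z) = -2 := by
    refine mul_left_cancel₀ hn0 ?_
    linear_combination ht
  have hsz : v (s * z) < 1 := by rw [v.map_mul]; exact mul_lt_one_of_lt_of_le hs1 hz
  have htv : v t < 1 := by
    have := congrArg v h1
    rw [v.map_mul, v.map_one_add_of_lt hsz, mul_one, v.map_neg] at this
    rwa [this]
  have h3 : (t + 2) * (1 + (s * z - (t - 2) * z)) = 0 := by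
    linear_combination h1 - z * hs
  have h4 : v (1 + (s * z - (t - 2) * z)) = 1 := by
    refine v.map_one_add_of_lt (v.map_sub_lt hsz ?_)
    rw [v.map_mul]
    exact mul_lt_one_of_lt_of_le (v.map_sub_lt htv h2) hz
  rcases mul_eq_zero.1 h3 with h | h
  · linear_combination h
  · rw [h] at h4; simp at h4

end

/-! ### Critical points of `Φ_{2n+1} / Φ_{2n-1}` -/

section

open Polynomial

variable {F Γ : Type} [Field F] [LinearOrderedCommGroupWithZero Γ] {v : Valuation F Γ}

theorem aeval_f_add_inv {y : F} (hy : y ≠ 0) (j : ℤ) :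
    (y - y⁻¹) * aeval (y + y⁻¹) (f j) = y ^ j - y ^ (-j) := by
  induction j using two_step_induction with
  | h0 => simp [f_zero]
  | h1 => simp [f_one]
  | hs n h1 h2 =>
    rw [f_add_one, map_sub, map_mul, aeval_X, mul_sub, h1,
      show (y - y⁻¹) * ((y + y⁻¹) * aeval (y + y⁻¹) (f n)) =
        (y + y⁻¹) * ((y - y⁻¹) * aeval (y + y⁻¹) (f n)) by ring, h2, neg_add, neg_sub,
      zpow_add₀ hy, zpow_sub₀ hy, zpow_sub₀ hy, zpow_add₀ hy, zpow_neg, zpow_neg, zpow_one]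
    field_simp
    ring
  | hp n h1 h2 =>
    rw [f_sub_one, map_sub, map_mul, aeval_X, mul_sub, h1,
      show (y - y⁻¹) * ((y + y⁻¹) * aeval (y + y⁻¹) (f n)) =
        (y + y⁻¹) * ((y - y⁻¹) * aeval (y + y⁻¹) (f n)) by ring, h2, neg_add, neg_sub,
      zpow_add₀ hy, zpow_sub₀ hy, zpow_sub₀ hy, zpow_add₀ hy, zpow_neg, zpow_neg, zpow_one]
    field_simp
    ring

theorem g_recurrence (j : ℤ) : g (j + 1) = X * g j - g (j - 1) := by
  rw [g_add_one, g, g, f_sub_one (j - 1), sub_add_cancel]; ring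

theorem aeval_g_add_inv {y : F} (hy : y ≠ 0) (j : ℤ) :
    (y + 1) * aeval (y + y⁻¹) (g j) = y ^ j + y ^ (1 - j) := by
  induction j using two_step_induction with
  | h0 =>
    have : g 0 = 1 := by
      have := f_neg 1
      rw [g, f_zero, zero_sub, zero_sub, this, f_one, neg_neg]
    simp [this]; ring
  | h1 => simp [g, f_zero, f_one]
  | hs n h1 h2 =>
    rw [g_recurrence, map_sub, map_mul, aeval_X, mul_sub, h1,
      show (y + 1) * ((y + y⁻¹) * aeval (y + y⁻¹) (g n)) =
        (y + y⁻¹) * ((y + 1) * aeval (y + y⁻¹) (g n)) by ring, h2]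
    simp only [sub_eq_add_neg, neg_add, neg_neg, zpow_add₀ hy, zpow_neg, zpow_one]
    field_simp
    ring
  | hp n h1 h2 =>
    have h3 : g (n - 1) = X * g n - g (n + 1) := by rw [g_recurrence]; ring
    rw [h3, map_sub, map_mul, aeval_X, mul_sub, h1,
      show (y + 1) * ((y + y⁻¹) * aeval (y + y⁻¹) (g n)) =
        (y + y⁻¹) * ((y + 1) * aeval (y + y⁻¹) (g n)) by ring, h2]
    simp only [sub_eq_add_neg, neg_add, neg_neg, zpow_add₀ hy, zpow_neg, zpow_one]
    field_simp
    ring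

/-- If `c = g_{n+1}(t) / g_n(t)` with `t = y + y⁻¹`, then `y^{2n} (c - y) = 1 - c y`. -/
theorem zpow_mul_sub_of_ratio {y c : F} (hy : y ≠ 0) {n : ℤ}
    (hc : c * aeval (y + y⁻¹) (g n) = aeval (y + y⁻¹) (g (n + 1))) :
    y ^ (2 * n) * (c - y) = 1 - c * y := by
  have h1 := aeval_g_add_inv hy n
  have h2 := aeval_g_add_inv hy (n + 1)
  rw [← hc] at h2
  have h3 : c * (y ^ n + y ^ (1 - n)) = y ^ (n + 1) + y ^ (1 - (n + 1)) := by
    rw [← h1, ← h2]; ring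
  simp only [sub_eq_add_neg, neg_add, zpow_add₀ hy, zpow_neg, zpow_one] at h3
  rw [two_mul, zpow_add₀ hy]
  field_simp at h3
  linear_combination h3

theorem exists_add_inv_eq [IsAlgClosed F] (hF : (2 : F) ≠ 0) (t : F) :
    ∃ y : F, y ≠ 0 ∧ t = y + y⁻¹ := by
  obtain ⟨s, hs⟩ := IsAlgClosed.exists_pow_nat_eq (t ^ 2 - 4) two_pos
  have h : ((t + s) / 2) * ((t - s) / 2) = 1 := by field_simp; linear_combination -hs
  refine ⟨(t + s) / 2, left_ne_zero_of_mul_eq_one h, ?_⟩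
  rw [← eq_inv_of_mul_eq_one_right h]
  field_simp; ring

/-- `t` is a critical point of `Φ_{2n+1} / Φ_{2n-1}` with critical value `c`. The fields are the
consequences of this that are used: the value of `f_{2n}`, the definition of `c`, and the quadratic
equation that relates them. The zero `-2` of `f_{2n} + 2n` is not critical. -/
structure IsCritical (n : ℤ) (t c : F) : Prop where
  value : aeval t (f (2 * n)) = -(2 * n : ℤ)
  ratio : c * aeval t (g n) = aeval t (g (n + 1))
  quad : (2 * n : ℤ) * (c ^ 2 - t * c + 1) = c ^ 2 - 1
  ne_neg_two : t ≠ -2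

theorem IsCritical.valuation_le_one {n : ℤ} (hn : n ≠ 0) {t c : F} (h : IsCritical n t c) :
    v t ≤ 1 := by
  have := h.value
  refine valuation_le_one_of_isIntegral v (isIntegral_of_aeval_f (j := 2 * n) (c := -(2 * n)) ?_ ?_)
  · rw [abs_mul, abs_two]
    have := Int.one_le_abs hn
    linarith
  · rw [this]; push_cast; ring

theorem IsCritical.valuation_value {n : ℤ} (hn : n ≠ 0) {t c : F} (h : IsCritical n t c)
    (h2 : v 2 < 1) : v c = 1 := by
  have := h.quad
  push_cast at this
  refine valuation_eq_one_of_quadratic (v := v) (a := ((2 * n - 1 : ℤ) : F)) (b := -(2 * n) * t)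
    (d := ((2 * n + 1 : ℤ) : F)) (valuation_odd h2 ⟨n - 1, by ring⟩) ?_
    (valuation_odd h2 ⟨n, by ring⟩) (by push_cast; linear_combination this)
  rw [v.map_mul, v.map_neg, v.map_mul]
  exact mul_le_one' (mul_le_one' h2.le (valuation_intCast_le_one v n)) (h.valuation_le_one hn)

/-- By `g_norm`, `g_n(t)² (c² - t c + 1) = 2 - t`, where `g_n(t)` is a unit because `g_n` and
`g_{n+1}` generate the unit ideal and `c` is a unit. -/
theorem IsCritical.valuation_quad {n : ℤ} (hn : n ≠ 0) {t c : F} (h : IsCritical n t c)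
    (h2 : v 2 < 1) : v (c ^ 2 - t * c + 1) = v (2 - t) := by
  have ht := h.valuation_le_one (v := v) hn
  have hg : v (aeval t (g n)) = 1 := by
    refine (valuation_aeval_le_one v ht _).antisymm ?_
    have e : aeval t (f n) * aeval t (g n) - aeval t (f (n - 1)) * aeval t (g (n + 1)) = 1 := by
      rw [aeval_g, aeval_g_add_one]
      linear_combination aeval_f_norm n t
    rw [← h.ratio] at e
    have e1 : aeval t (g n) * (aeval t (f n) - aeval t (f (n - 1)) * c) = 1 := by
      linear_combination e
    have e2 : v (aeval t (f n) - aeval t (f (n - 1)) * c) ≤ 1 := by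
      refine v.map_sub_le (valuation_aeval_le_one v ht _) ?_
      rw [v.map_mul, h.valuation_value hn h2, mul_one]
      exact valuation_aeval_le_one v ht _
    have e3 := congrArg v e1
    rw [v.map_mul, v.map_one] at e3
    rw [← e3]
    exact mul_le_of_le_one_right' e2
  have := g_norm n t
  rw [← h.ratio] at this
  rw [← this, show aeval t (g n) ^ 2 - t * aeval t (g n) * (c * aeval t (g n)) +
    (c * aeval t (g n)) ^ 2 = aeval t (g n) ^ 2 * (c ^ 2 - t * c + 1) by ring, v.map_mul, v.map_pow,
    hg, one_pow, one_mul]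

/-- A critical point is congruent to `2`, if at all, then only to a bounded precision, and
`2 - t`, `2 + t` have the same valuation, which is larger than `v 2`. -/
theorem IsCritical.lt_valuation [CharZero F] {n : ℤ} (hn : n ≠ 0) {t c : F}
    (h : IsCritical n t c) (h2 : v 2 < 1) :
    v 2 < v (2 - t) ∧ v (t ^ 2 - 4) = v (2 - t) ^ 2 := by
  have hπ : 0 < v 2 := zero_lt_iff.2 ((v.ne_zero_iff).2 two_ne_zero)
  have h4 : v 4 = v 2 * v 2 := by rw [← v.map_mul]; norm_num
  have h5 : v 2 * v 2 < v 2 := mul_lt_of_lt_one_right hπ h2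
  have h1 : v 2 < v (2 - t) := by
    by_contra hle
    rw [not_lt] at hle
    refine h.ne_neg_two (eq_neg_two_of_valuation_lt h2 hn h.value ?_)
    rw [show t ^ 2 - 4 = (2 - t) * ((2 - t) - 4) by ring, v.map_mul]
    have : v (2 - t - 4) ≤ v 2 := v.map_sub_le hle (h4 ▸ h5.le)
    exact (mul_le_mul' hle this).trans_lt h5
  refine ⟨h1, ?_⟩
  rw [show t ^ 2 - 4 = (2 - t) * ((2 - t) - 4) by ring, v.map_mul,
    v.map_sub_eq_of_lt_left (x := 2 - t) (y := 4) (by rw [h4]; exact h5.trans h1), sq]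

end

/-! ### Two-adic estimates at critical points -/

section

open Polynomial

variable {F Γ : Type} [Field F] [LinearOrderedCommGroupWithZero Γ] {v : Valuation F Γ}

/-- If `E` and `E'` lie strictly between `π` and `1`, the end point `1` being allowed, then
`π ^ a * E` determines `a`. -/
theorem eq_of_pow_mul_eq {π E E' : Γ} (hπ0 : 0 < π) (hE : π < E) (hE' : π < E') (h1 : E ≤ 1)
    (h1' : E' ≤ 1) (hπ : π < 1) {a b : ℕ} (h : π ^ a * E = π ^ b * E') : a = b := by
  have key : ∀ {E E' : Γ} {a b : ℕ}, π < E → E' ≤ 1 → π ^ a * E = π ^ b * E' → ¬ a < b := by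
    intro E E' a b hE h1' h hab
    obtain ⟨i, rfl⟩ := Nat.exists_eq_add_of_lt hab
    rw [add_assoc, pow_add, mul_assoc] at h
    have h' := mul_left_cancel₀ (pow_ne_zero a hπ0.ne') h
    refine hE.not_ge ?_
    rw [h', pow_succ', mul_assoc]
    exact mul_le_of_le_one_right' (mul_le_one' (pow_le_one' hπ.le i) h1')
  exact le_antisymm (not_lt.1 (key hE' h1 h.symm)) (not_lt.1 (key hE h1' h))

theorem valuation_two_pow_mul (h2 : v 2 < 1) {m : ℤ} (hm : Odd m) (a : ℕ) :
    v ((2 ^ a * m : ℤ) : F) = v 2 ^ a := by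
  push_cast
  rw [v.map_mul, v.map_pow, valuation_odd h2 hm, mul_one]

theorem valuation_add_inv {x : F} (hx0 : x ≠ 0) (hx : v (x + x⁻¹) ≤ 1) : v x = 1 := by
  refine valuation_eq_one_of_quadratic (v := v) (a := 1) (b := -(x + x⁻¹)) (d := 1) v.map_one
    (by rwa [v.map_neg]) v.map_one ?_
  field_simp; ring

theorem valuation_sub_inv {x : F} (hx0 : x ≠ 0) {E : Γ} (h : v ((x + x⁻¹) ^ 2 - 4) = E ^ 2) :
    v (x - x⁻¹) = E := by
  rw [show (x + x⁻¹) ^ 2 - 4 = (x - x⁻¹) ^ 2 by field_simp; ring, v.map_pow] at h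
  exact (pow_left_inj₀ zero_le zero_le two_ne_zero).1 h

/-- If `r` and `t` are close, then among the solutions of `r = x + x⁻¹` and `t = y + y⁻¹` there is a
pair for which `x` and `y` are close, while `x` and `y⁻¹` are not. -/
theorem exists_close_add_inv [IsAlgClosed F] (h20 : (2 : F) ≠ 0) {r t : F} {E : Γ}
    (hr : v r ≤ 1) (ht : v t ≤ 1) (hE : v (t ^ 2 - 4) = E ^ 2) (hrt : v (r - t) < E ^ 2) :
    ∃ x y : F, x ≠ 0 ∧ y ≠ 0 ∧ r = x + x⁻¹ ∧ t = y + y⁻¹ ∧ v x = 1 ∧ v y = 1 ∧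
      v (x - y) * E = v (r - t) := by
  obtain ⟨x, hx0, rfl⟩ := exists_add_inv_eq h20 r
  have hx := valuation_add_inv hx0 hr
  have key : ∀ y : F, y ≠ 0 → t = y + y⁻¹ → v (x - y) < E → v (x - y) * E = v (x + x⁻¹ - t) := by
    intro y hy h hlt
    rw [h] at hE
    have h1 := valuation_sub_inv hy hE
    have h2 : v (x - y⁻¹) = E := by
      rw [show x - y⁻¹ = (x - y) + (y - y⁻¹) by ring, v.map_add_eq_of_lt_right (by rwa [h1]), h1]
    rw [← h2, ← v.map_mul, h, show (x - y) * (x - y⁻¹) = x * (x + x⁻¹ - (y + y⁻¹)) by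
      field_simp; ring, v.map_mul, hx, one_mul]
  obtain ⟨y, hy0, hy⟩ := exists_add_inv_eq h20 t
  have hvy : v y = 1 := valuation_add_inv hy0 (by rwa [← hy])
  by_cases hlt : v (x - y) < E
  · exact ⟨x, y, hx0, hy0, rfl, hy, hx, hvy, key y hy0 hy hlt⟩
  · have hy' : t = y⁻¹ + y⁻¹⁻¹ := by rw [inv_inv, hy, add_comm]
    refine ⟨x, y⁻¹, hx0, inv_ne_zero hy0, rfl, hy', hx, by rw [map_inv₀, hvy, inv_one],
      key _ (inv_ne_zero hy0) hy' ?_⟩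
    by_contra h
    rw [not_lt] at h hlt
    refine hrt.not_ge ?_
    have e : v (x + x⁻¹ - t) = v (x - y) * v (x - y⁻¹) := by
      rw [← v.map_mul, hy, show (x - y) * (x - y⁻¹) = x * (x + x⁻¹ - (y + y⁻¹)) by
        field_simp; ring, v.map_mul, hx, one_mul]
    rw [e, sq]
    exact mul_le_mul' hlt h

theorem IsCritical.zpow_sub_neg {n : ℤ} {y c : F} (hy : y ≠ 0) (h : IsCritical n (y + y⁻¹) c) :
    y ^ (2 * n) - y ^ (-(2 * n)) = -(2 * n) * (y - y⁻¹) := by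
  rw [← aeval_f_add_inv hy, h.value]
  push_cast; ring

theorem IsCritical.valuation_zpow_sub_one {n : ℤ} {y c : F} {E : Γ} (hy : y ≠ 0) (hvy : v y = 1)
    (h : IsCritical n (y + y⁻¹) c) (hE : v (y - y⁻¹) = E) :
    v (y ^ (2 * (2 * n)) - 1) = v (2 * n : ℤ) * E := by
  have h1 := congrArg (y ^ (2 * n) * ·) (h.zpow_sub_neg hy)
  simp only [mul_sub, ← zpow_add₀ hy, add_neg_cancel, zpow_zero] at h1
  rw [two_mul (2 * n), h1, ← mul_sub, ← mul_sub, v.map_mul, v.map_mul, map_zpow₀, hvy, hE, one_zpow,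
      one_mul,
    v.map_neg]
  push_cast; rfl

/-- A case of small ramification, in which `y^{4n} - 1` has valuation `v 2` with `n` odd and
`y - y⁻¹` a unit. If `y^{4n} + 1` were divisible by `4`, then `y^{2n} ≡ -n (y - y⁻¹)` modulo `2`
would give `(y - y⁻¹)² ≡ -1`, hence `y^6 ≡ 1`, modulo `2`; according to `n` modulo `3`, this
contradicts the valuation of `y^{4n} - 1` or of `y² - 1`. -/
theorem IsCritical.not_near_neg_one (h2 : v 2 < 1) {n : ℤ} (hn : Odd n) {y c : F} (hy : y ≠ 0)
    (hvy : v y = 1) (h : IsCritical n (y + y⁻¹) c) (hE : v (y - y⁻¹) = 1)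
    (hw : v (y ^ (2 * (2 * n)) - 1) = v 2) (hw' : v (y ^ (2 * (2 * n)) + 1) ≤ v 2 ^ 2) :
    v 2 = 0 := by
  by_contra h0
  have hπ : 0 < v 2 := zero_lt_iff.2 h0
  have h20 : (2 : F) ≠ 0 := (v.ne_zero_iff).1 h0
  have hsq : v 2 ^ 2 < v 2 := by rw [sq]; exact mul_lt_of_lt_one_right hπ h2
  have hz : v (y ^ (2 * n)) = 1 := by rw [map_zpow₀, hvy, one_zpow]
  set z := y ^ (2 * n) with hzdef
  have hz0 : z ≠ 0 := zpow_ne_zero _ hy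
  have hwz : y ^ (2 * (2 * n)) = z ^ 2 := by rw [two_mul (2 * n), zpow_add₀ hy, sq]
  rw [hwz] at hw hw'
  set δ := y - y⁻¹
  have h1 := h.zpow_sub_neg hy
  rw [zpow_neg, ← hzdef] at h1
  have h3 : v (z + n * δ) ≤ v 2 := by
    have e : 2 * (z + n * δ) = z⁻¹ * (z ^ 2 + 1) := by
      have h1' : z ^ 2 - 1 = z * (-(2 * n) * δ) := by
        rw [← h1, mul_sub, mul_inv_cancel₀ hz0, sq]
      rw [eq_inv_mul_iff_mul_eq₀ hz0]
      linear_combination h1'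
    have e' := congrArg v e
    rw [v.map_mul, v.map_mul, map_inv₀, hz, inv_one, one_mul] at e'
    rw [← e', sq] at hw'
    exact (mul_le_mul_iff_right₀ hπ).1 hw'
  have hnδ : v (n * δ) ≤ 1 := by rw [v.map_mul, hE, mul_one]; exact valuation_intCast_le_one v n
  have h4 : v (δ ^ 2 + 1) ≤ v 2 := by
    obtain ⟨i, hi⟩ := hn
    have e : δ ^ 2 + 1 = (z ^ 2 + 1) - (z + n * δ) * (z - n * δ) - 2 * (2 * i * (i + 1) * δ ^ 2) :=
        by
      rw [hi]; push_cast; ring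
    rw [e]
    refine v.map_sub_le (v.map_sub_le (hw'.trans hsq.le) ?_) ?_
    · rw [v.map_mul]
      exact (mul_le_of_le_one_right' (v.map_sub_le hz.le hnδ)).trans h3
    · have : ((2 * i * (i + 1) : ℤ) : F) = 2 * i * (i + 1) := by push_cast; ring
      rw [v.map_mul, v.map_mul, v.map_pow, hE, one_pow, mul_one, ← this]
      exact mul_le_of_le_one_right' (valuation_intCast_le_one v _)
  have h6 : v (y ^ (6 : ℕ) - 1) ≤ v 2 := by
    have e : y ^ 6 - 1 = (y ^ 2 + 1) * y ^ 2 * (δ ^ 2 + 1) - 2 := by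
      simp only [δ]; field_simp; ring
    rw [e]
    refine v.map_sub_le ?_ le_rfl
    rw [v.map_mul]
    refine (mul_le_of_le_one_left' ?_).trans h4
    rw [v.map_mul, v.map_pow, hvy, one_pow, mul_one]
    exact v.map_add_le (by rw [v.map_pow, hvy, one_pow]) v.map_one.le
  have hvp : ∀ i : ℕ, v (y ^ i) = 1 := fun i => by rw [v.map_pow, hvy, one_pow]
  have h12 : v (y ^ (12 : ℕ) - 1) ≤ v 2 ^ 2 := by
    rw [show y ^ 12 = (y ^ 6) ^ 2 by ring, sq (v 2)]
    exact (valuation_sq_sub_one_le h6).trans (mul_le_mul_right h6 _)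
  have h12' : ∀ q : ℤ, v (y ^ (12 * q) - 1) ≤ v 2 ^ 2 := fun q => by
    rw [zpow_mul]
    exact (valuation_zpow_sub_one_le (by exact_mod_cast hvp 12) q).trans (by exact_mod_cast h12)
  have h2' : v (y ^ (2 : ℕ) - 1) = 1 := by
    rw [show y ^ 2 - 1 = y * δ by simp only [δ]; field_simp, v.map_mul, hvy, hE, one_mul]
  rw [← hwz] at hw
  -- If `3` does not divide `n`, then `y ^ 4`, hence also `y ^ 2`, is near `1`.
  have h4' : v (y ^ (4 : ℕ) - 1) ≤ v 2 → False := by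
    intro h4'
    have e : y ^ 2 - 1 = (y ^ 6 - 1) - y ^ 2 * (y ^ 4 - 1) := by ring
    have : v (y ^ 2 - 1) ≤ v 2 := by
      rw [e]
      refine v.map_sub_le h6 ?_
      rw [v.map_mul, hvp, one_mul]
      exact h4'
    rw [h2'] at this
    exact h2.not_ge this
  have hmod : n % 3 = 0 ∨ n % 3 = 1 ∨ n % 3 = 2 := by omega
  rcases hmod with hm | hm | hm
  · have := h12' (n / 3)
    rw [show 12 * (n / 3) = 2 * (2 * n) by omega, hw] at this
    exact hsq.not_ge this
  · refine h4' ?_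
    have e : y ^ (4 : ℕ) = y ^ (12 * (-(n / 3))) * y ^ (2 * (2 * n)) := by
      rw [← zpow_add₀ hy, ← zpow_natCast]
      congr 1; push_cast; omega
    rw [e]
    exact valuation_mul_sub_one (by rw [map_zpow₀, hvy, one_zpow]) ((h12' _).trans hsq.le) hw.le
  · refine h4' ?_
    rw [← valuation_inv_sub_one (hvp 4)]
    have e : (y ^ (4 : ℕ))⁻¹ = y ^ (12 * (-(n / 3 + 1))) * y ^ (2 * (2 * n)) := by
      rw [← zpow_add₀ hy, ← zpow_natCast, ← zpow_neg]
      congr 1; push_cast; omega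
    rw [e]
    exact valuation_mul_sub_one (by rw [map_zpow₀, hvy, one_zpow]) ((h12' _).trans hsq.le) hw.le

end

/-! ### Critical values for different even indices -/

section

open Polynomial

variable {F Γ : Type} [Field F] [LinearOrderedCommGroupWithZero Γ] {v : Valuation F Γ}

/-- Critical points for different even indices have different critical values. -/
theorem IsCritical.false_of_ne [CharZero F] [IsAlgClosed F] (h2 : v 2 < 1) {m n : ℤ} (hm : m ≠ 0)
    (hn : n ≠ 0) (hmn : m ≠ n) {r t c : F} (hr : IsCritical m r c) (ht : IsCritical n t c) :
    False := by
  have hπ : 0 < v 2 := zero_lt_iff.2 ((v.ne_zero_iff).2 two_ne_zero)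
  have h20 : (2 : F) ≠ 0 := two_ne_zero
  obtain ⟨a, m', hm', rfl⟩ := exists_two_pow_mul hm
  obtain ⟨b, n', hn', rfl⟩ := exists_two_pow_mul hn
  have hrv := hr.valuation_le_one (v := v) hm
  have htv := ht.valuation_le_one (v := v) hn
  have hcv := ht.valuation_value hn h2
  obtain ⟨hrE, hrE2⟩ := hr.lt_valuation hm h2
  obtain ⟨htE, htE2⟩ := ht.lt_valuation hn h2
  have hr1 : v (2 - r) ≤ 1 := v.map_sub_le h2.le hrv
  have ht1 : v (2 - t) ≤ 1 := v.map_sub_le h2.le htv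
  have hvm : v ((2 * (2 ^ a * m') : ℤ) : F) = v 2 ^ (a + 1) := by
    rw [← mul_assoc, ← pow_succ', valuation_two_pow_mul h2 hm']
  have hvn : v ((2 * (2 ^ b * n') : ℤ) : F) = v 2 ^ (b + 1) := by
    rw [← mul_assoc, ← pow_succ', valuation_two_pow_mul h2 hn']
  have hcr := congrArg v hr.quad
  have hct := congrArg v ht.quad
  rw [v.map_mul, hr.valuation_quad hm h2, hvm] at hcr
  rw [v.map_mul, ht.valuation_quad hn h2, hvn] at hct
  obtain rfl : a = b := Nat.succ_injective
    (eq_of_pow_mul_eq hπ hrE htE hr1 ht1 h2 (hcr.trans hct.symm))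
  have hEE : v (2 - r) = v (2 - t) :=
    mul_left_cancel₀ (pow_ne_zero _ hπ.ne') (hcr.trans hct.symm)
  rw [hEE] at hrE2
  clear hEE hrE hr1 hcr
  set E := v (2 - t)
  have hE0 : 0 < E := hπ.trans htE
  -- The exact power of `2` in the difference of the indices.
  obtain ⟨j, e, he, hje⟩ : ∃ (j : ℕ) (e : ℤ), Odd e ∧ m' - n' = 2 ^ (j + 1) * e := by
    obtain ⟨i, e, he, h⟩ := exists_two_pow_mul (n := m' - n')
      (fun h => hmn (by rw [sub_eq_zero.1 h]))
    cases i with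
    | zero =>
      rw [pow_zero, one_mul] at h
      exact absurd (h ▸ he) (by rw [Int.not_odd_iff_even]; exact hm'.sub_odd hn')
    | succ j => exact ⟨j, e, he, h⟩
  have hrt : v (r - t) = v 2 ^ (j + 1) * E := by
    have e1 : (r - t) * c * (2 * (2 ^ a * m') : ℤ) * (2 * (2 ^ a * n') : ℤ) =
        (c ^ 2 - 1) * (2 ^ (a + 1 + (j + 1)) * e : ℤ) := by
      have h3 : ((2 ^ (a + 1 + (j + 1)) * e : ℤ) : F) = 2 * (2 ^ a * m') - 2 * (2 ^ a * n') := by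
        rw [pow_add, mul_assoc, ← hje]; push_cast; ring
      have h4 := hr.quad
      have h5 := ht.quad
      push_cast at h3 h4 h5 ⊢
      linear_combination (-(2 * (2 ^ a * (n' : F)))) * h4 + 2 * (2 ^ a * (m' : F)) * h5 -
        (c ^ 2 - 1) * h3
    have e2 := congrArg v e1
    rw [v.map_mul, v.map_mul, v.map_mul, v.map_mul, hcv, hvm, hvn, ← hct,
      valuation_two_pow_mul h2 he, mul_one, pow_add _ (a + 1)] at e2
    have hp := pow_ne_zero (a + 1) hπ.ne'
    refine mul_right_cancel₀ hp (mul_right_cancel₀ hp (e2.trans ?_))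
    simp only [mul_assoc, mul_comm, mul_left_comm]
  have hjπ : v 2 ^ (j + 1) ≤ v 2 := by
    rw [pow_succ']; exact mul_le_of_le_one_right' (pow_le_one' h2.le j)
  obtain ⟨x, y, hx0, hy0, rfl, rfl, hx, hy, hxy⟩ := exists_close_add_inv h20 hrv htv htE2 (by
    rw [hrt, sq]
    exact mul_lt_mul_of_pos_right (hjπ.trans_lt htE) hE0)
  have hxy : v (x - y) = v 2 ^ (j + 1) := mul_right_cancel₀ hE0.ne' (hxy.trans hrt)
  have hx1 := valuation_sub_inv hx0 hrE2
  have hy1 := valuation_sub_inv hy0 htE2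
  -- The distances of `c` to the four points `x`, `y`, `x⁻¹`, `y⁻¹`.
  have hcy : v (c - y) * v (1 - c * y) = E := by
    have h3 := ht.valuation_quad hn h2
    rw [show c ^ 2 - (y + y⁻¹) * c + 1 = -(y⁻¹ * ((c - y) * (1 - c * y))) by field_simp; ring,
      v.map_neg, v.map_mul, map_inv₀, hy, inv_one, one_mul, v.map_mul] at h3
    exact h3
  have hcy0 : E ≤ v (c - y) := by
    rw [← hcy]
    refine mul_le_of_le_one_right' (v.map_sub_le v.map_one.le ?_)
    rw [v.map_mul, hcv, hy, one_mul]
  have hcx : v (c - x) = v (c - y) := by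
    rw [show c - x = (c - y) - (x - y) by ring]
    refine v.map_sub_eq_of_lt_left ?_
    rw [hxy]
    exact (hjπ.trans_lt htE).trans_le hcy0
  have hcy0' : c - y ≠ 0 := by
    intro h; rw [h, v.map_zero] at hcy0; exact hE0.not_ge hcy0
  have hcx0' : c - x ≠ 0 := by
    intro h; rw [h, v.map_zero] at hcx; exact hE0.not_ge (hcx ▸ hcy0)
  have h1cy : 1 - c * y ≠ 0 := by
    intro h; rw [h, v.map_zero, mul_zero] at hcy; exact hE0.ne hcy
  have hX := zpow_mul_sub_of_ratio hx0 hr.ratio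
  have hY := zpow_mul_sub_of_ratio hy0 ht.ratio
  set k := 2 * (2 ^ a * m')
  set l := 2 * (2 ^ a * n')
  -- The relations `hX` and `hY` express `x ^ k * y ^ (-l) - 1` by the distances above.
  have hkl : v (x ^ k * y ^ (-l) - 1) = v 2 ^ (a + 1 + (j + 1)) := by
    have e1 : x ^ k * y ^ (-l) - 1 = (x - y) * -(c ^ 2 - 1) / ((c - x) * (1 - c * y)) := by
      rw [zpow_neg, eq_div_iff (mul_ne_zero hcx0' h1cy), ← hY]
      field_simp
      linear_combination (c - y) * hX - (c - x) * hY
    rw [e1, map_div₀, v.map_mul, v.map_mul, hcx, hcy, v.map_neg, ← hct, hxy]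
    rw [div_eq_iff hE0.ne', pow_add _ (a + 1)]
    simp only [mul_assoc, mul_comm]
  have hxyl : v ((y * x⁻¹) ^ l - 1) ≤ v 2 ^ (a + 1 + (j + 1)) := by
    have e1 : v (y * x⁻¹ - 1) = v 2 ^ (j + 1) := by
      rw [show y * x⁻¹ - 1 = -(x⁻¹ * (x - y)) by field_simp; ring, v.map_neg, v.map_mul, map_inv₀,
        hx, inv_one, one_mul, hxy]
    have e2 : l = (2 ^ (a + 1) : ℕ) * n' := by simp only [l]; push_cast; ring
    have e3 : v (y * x⁻¹) = 1 := by rw [v.map_mul, map_inv₀, hx, hy, inv_one, mul_one]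
    rw [e2, zpow_mul, zpow_natCast, pow_add (v 2), ← e1]
    exact (valuation_zpow_sub_one_le (by rw [v.map_pow, e3, one_pow]) n').trans
      (valuation_pow_two_pow_sub_one_le h2 (by rwa [e1]) _)
  have hxkl : v (x ^ (k - l) - 1) ≤ v 2 ^ (a + 1 + (j + 1)) := by
    have e1 : x ^ (k - l) = (x ^ k * y ^ (-l)) * (y * x⁻¹) ^ l := by
      rw [mul_zpow, inv_zpow, zpow_sub₀ hx0, zpow_neg]
      field_simp
    rw [e1]
    exact valuation_mul_sub_one (by rw [v.map_mul, map_zpow₀, map_zpow₀, hx, hy]; simp) hkl.le hxyl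
  set w := x ^ (2 * k)
  have hvw : v w = 1 := by rw [map_zpow₀, hx, one_zpow]
  have hw : v (w - 1) = v 2 ^ (a + 1) * E := by
    rw [hr.valuation_zpow_sub_one hx0 hx hx1, hvm]
  have hwlt : v (w - 1) < 1 := by
    rw [hw, pow_succ', mul_assoc]
    exact mul_lt_one_of_lt_of_le h2 (mul_le_one' (pow_le_one' h2.le a) ht1)
  have hwj : v (w ^ 2 ^ j - 1) ≤ v 2 ^ (a + 1 + (j + 1)) := by
    -- Both sides are the same power of `x`; odd powers do not change the distance to `1`.
    have e1 : (w ^ 2 ^ j) ^ e = (x ^ (k - l)) ^ m' := by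
      rw [← zpow_natCast, ← zpow_mul, ← zpow_mul, ← zpow_mul]
      congr 1
      have : k - l = 2 ^ (a + 1) * (m' - n') := by simp only [k, l]; ring
      rw [this, hje]
      simp only [k]; push_cast; ring
    have e2 : v (w ^ 2 ^ j - 1) < 1 := (valuation_pow_sub_one_le hvw _).trans_lt hwlt
    rw [← valuation_zpow_sub_one_of_odd h2 e2 he, e1]
    exact (valuation_zpow_sub_one_le (by rw [map_zpow₀, hx, one_zpow]) m').trans hxkl
  have hcancel : ∀ {i : ℕ} {A B : Γ}, v 2 ^ i * A ≤ v 2 ^ i * B → A ≤ B := fun {i A B} h =>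
    (mul_le_mul_iff_right₀ (pow_pos hπ i)).1 h
  -- Squaring `j` times multiplies `v (w - 1)` by `v 2 ^ j`, which makes it too large for `hwj`.
  by_cases hlt : v (w - 1) < v 2
  · rw [valuation_pow_two_pow_sub_one h2 hlt, hw, ← mul_assoc, ← pow_add, add_comm j,
      ← add_assoc, pow_succ] at hwj
    exact htE.not_ge (hcancel hwj)
  -- Otherwise `a = 0` and `E = 1`, and squaring brings `w` close to `1` only if `w` is near `-1`.
  · rw [not_lt, hw] at hlt
    have hsq : v 2 * v 2 < v 2 := mul_lt_of_lt_one_right hπ h2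
    obtain rfl : a = 0 := by
      by_contra ha
      obtain ⟨a, rfl⟩ := Nat.exists_eq_succ_of_ne_zero ha
      refine hsq.not_ge (hlt.trans ?_)
      rw [pow_succ', pow_succ', ← mul_assoc, mul_assoc]
      exact mul_le_of_le_one_right' (mul_le_one' (pow_le_one' h2.le a) ht1)
    rw [zero_add, pow_one] at hlt hw
    have hE1 : E = 1 := by
      refine ht1.antisymm ((mul_le_mul_iff_right₀ hπ).1 ?_)
      rwa [mul_one]
    rw [hE1, mul_one] at hw
    rw [hE1] at hx1
    refine hπ.ne' ?_
    simp only [pow_zero, one_mul] at hr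
    have hk : k = 2 * m' := by simp only [k]; ring
    refine hr.not_near_neg_one h2 hm' hx0 hx hx1 (by rw [← hk]; exact hw) ?_
    rw [← hk]
    change v (w + 1) ≤ _
    cases j with
    | zero =>
      simp only [pow_zero, pow_one, zero_add] at hwj
      rw [hw, show 1 + 1 = 2 from rfl, sq] at hwj
      exact absurd hwj hsq.not_ge
    | succ i =>
      have h5 : v (w + 1) ≤ v 2 := by
        rw [show w + 1 = (w - 1) + 2 by ring]
        exact v.map_add_le hw.le le_rfl
      have h6 : v (w ^ 2 - 1) = v 2 * v (w + 1) := by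
        rw [show w ^ 2 - 1 = (w - 1) * (w + 1) by ring, v.map_mul, hw]
      have h7 : v (w ^ 2 - 1) < v 2 := by
        rw [h6]
        exact (mul_le_mul_right h5 _).trans_lt hsq
      rw [pow_succ' 2 i, pow_mul, valuation_pow_two_pow_sub_one h2 h7, h6, ← mul_assoc, ← pow_succ,
        show 0 + 1 + (i + 1 + 1) = (i + 1) + 2 by ring, pow_add _ (i + 1)] at hwj
      exact hcancel hwj

end

/-! ### Absence of affine singular points -/

section

open Polynomial

variable {F : Type} [Field F]

/-- A field of characteristic zero has a valuation above `2`. -/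
theorem exists_valuationSubring_two (F : Type) [Field F] [CharZero F] :
    ∃ O : ValuationSubring F, O.valuation 2 < 1 := by
  let A := (Int.castRingHom F).range
  have hI : Ideal.span {(2 : A)} ≠ ⊤ := by
    rw [Ne, Ideal.span_singleton_eq_top]
    intro h
    obtain ⟨⟨_, n, rfl⟩, hb⟩ := h.exists_right_inv
    have := congrArg Subtype.val hb
    have h2 : ((2 * n : ℤ) : F) = (1 : ℤ) := by push_cast; exact this
    have := Int.cast_injective h2
    omega
  obtain ⟨O, hO, h⟩ := Ideal.image_subset_nonunits_valuationSubring _ hI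
  exact ⟨O, O.mem_nonunits_iff.1 (h ⟨2, Ideal.mem_span_singleton_self _, rfl⟩)⟩

theorem aeval_f_of_wr_even {n : ℤ} {t : F} (h : aeval t (wr (2 * n)) = 0) :
    aeval t (f (2 * n)) = -(2 * n : ℤ) := by
  have := congrArg (aeval t) (wr_two_mul n)
  simp [h, map_ofNat] at this
  push_cast
  linear_combination -this

theorem aeval_f_of_wr_odd {n : ℤ} {t : F} (h : aeval t (wr (2 * n - 1)) = 0) :
    aeval t (f (2 * n - 1)) = (2 * n - 1 : ℤ) := by
  have := congrArg (aeval t) (wr_two_mul_sub_one n)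
  simp [h, map_ofNat] at this
  push_cast
  linear_combination -this

variable [CharZero F]

theorem ne_neg_two_of_wr {n : ℤ} (hn : n ≠ 0) {t : F} (h : aeval t (wr (2 * n)) = 0) : t ≠ -2 := by
  rintro rfl
  rw [show (-2 : F) = algebraMap ℤ F (-2) by simp, aeval_algebraMap_apply_eq_algebraMap_eval] at h
  exact wr_eval_neg_two hn (by simpa using h)

theorem ne_two_of_wr {n : ℤ} (hn : n ≠ 0) {t : F} (h : aeval t (wr (2 * n)) = 0) : t ≠ 2 := by
  rintro rfl
  have h1 := aeval_f_of_wr_even h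
  rw [show (2 : F) = algebraMap ℤ F 2 by simp, aeval_algebraMap_apply_eq_algebraMap_eval,
    f_eval_two] at h1
  have : (2 * n : ℤ) = -(2 * n) := by
    apply Int.cast_injective (α := F)
    simpa using h1
  omega

theorem aeval_g_ne_zero_of_wr {n : ℤ} (hn : n ≠ 0) {t : F} (h : aeval t (wr (2 * n)) = 0) :
    aeval t (g n) ≠ 0 := by
  intro h0
  have h1 := g_norm n t
  have h2 := g_sq_sub_sq n t
  rw [aeval_f_of_wr_even h, h0] at h2
  rw [h0] at h1
  have h3 : (2 - t) * (2 * n - 1 : ℤ) = 0 := by push_cast at h2 ⊢; linear_combination h1 - h2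
  rcases mul_eq_zero.1 h3 with h3 | h3
  · exact ne_two_of_wr hn h (by linear_combination -h3)
  · rw [Int.cast_eq_zero] at h3
    omega

theorem isCritical_of_wr {n : ℤ} (hn : n ≠ 0) {t c : F} (h : aeval t (wr (2 * n)) = 0)
    (hc : c * aeval t (g n) = aeval t (g (n + 1))) : IsCritical n t c := by
  refine ⟨aeval_f_of_wr_even h, hc, ?_, ne_neg_two_of_wr hn h⟩
  have h1 := g_norm n t
  have h2 := g_sq_sub_sq n t
  rw [aeval_f_of_wr_even h] at h2
  rw [← hc] at h1 h2
  refine mul_left_cancel₀ (pow_ne_zero 2 (aeval_g_ne_zero_of_wr hn h)) ?_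
  push_cast at *
  linear_combination 2 * (n : F) * h1 - h2

/-- For a given index, the critical value determines the critical point. -/
theorem IsCritical.eq {n : ℤ} (hn : n ≠ 0) {r t c : F} (hr : IsCritical n r c)
    (ht : IsCritical n t c) : r = t := by
  have h1 : (r - t) * c = 0 := by
    have hn' : (2 * n : F) ≠ 0 := mul_ne_zero two_ne_zero (Int.cast_ne_zero.2 hn)
    refine mul_left_cancel₀ hn' ?_
    have h1 := hr.quad
    have h2 := ht.quad
    push_cast at h1 h2
    linear_combination h2 - h1
  rcases mul_eq_zero.1 h1 with h | rfl
  · exact sub_eq_zero.1 h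
  · have h2 := ht.quad
    have h3 : ((2 * n + 1 : ℤ) : F) = 0 := by push_cast at h2 ⊢; linear_combination h2
    rw [Int.cast_eq_zero] at h3
    omega

theorem exists_isCritical {m n : ℤ} (hm : m ≠ 0) (hn : n ≠ 0) {r t : F}
    (hr : aeval r (wr (2 * m)) = 0) (ht : aeval t (wr (2 * n)) = 0)
    (h : aeval r (Phi (2 * m + 1)) * aeval t (Phi (2 * n - 1)) =
      aeval r (Phi (2 * m - 1)) * aeval t (Phi (2 * n + 1))) :
    ∃ c, IsCritical m r c ∧ IsCritical n t c := by
  rw [Phi_odd, Phi_odd, show 2 * m + 1 = 2 * (m + 1) - 1 by ring,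
    show 2 * n + 1 = 2 * (n + 1) - 1 by ring, Phi_odd, Phi_odd] at h
  have hg := aeval_g_ne_zero_of_wr hn ht
  refine ⟨aeval t (g (n + 1)) / aeval t (g n), isCritical_of_wr hm hr ?_,
    isCritical_of_wr hn ht ?_⟩
  · rw [div_mul_eq_mul_div, div_eq_iff hg, h, mul_comm]
  · rw [div_mul_cancel₀ _ hg]

/-- The reduction modulo `2` of the conditions on a singular point, for `k = 2m - 1` odd and
`l = 2n`, has no solution. -/
theorem false_of_residue {κ : Type} [Field κ] {m n : ℤ} {x y : κ}
    (h1 : aeval x (f (2 * m - 1)) = 1) (h2 : aeval y (f (2 * n)) = 0)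
    (h : aeval x (Phi (2 * m - 1 + 1)) * aeval y (Phi (2 * n - 1)) =
      aeval x (Phi (2 * m - 1 - 1)) * aeval y (Phi (2 * n + 1))) : False := by
  have hP : Phi (2 * n + 1) = g (n + 1) := by
    rw [show 2 * n + 1 = 2 * (n + 1) - 1 by ring, Phi_odd]
  have h5 := g_sq_sub_sq n y
  rw [h2, mul_zero] at h5
  rw [f_two_mul_sub_one, map_sub, map_pow, map_pow] at h1
  rw [sub_add_cancel, Phi_even, Phi_odd, hP, show 2 * m - 1 - 1 = 2 * (m - 1) by ring,
    Phi_even] at h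
  have h6 : aeval y (g n) ^ 2 = 0 := by
    linear_combination (-(aeval y (g n) ^ 2)) * h1 + (aeval x (f m) * aeval y (g n) +
      aeval x (f (m - 1)) * aeval y (g (n + 1))) * h + (aeval x (f (m - 1))) ^ 2 * h5
  rw [h6, sub_zero] at h5
  refine Phi_pair_ne_zero (2 * n) y ⟨?_, ?_⟩
  · rw [Phi_odd]; exact pow_eq_zero_iff two_ne_zero |>.1 h6
  · rw [hP]; exact pow_eq_zero_iff two_ne_zero |>.1 h5

/-- There are no affine singular points for odd `k`. -/
theorem false_of_odd {m n : ℤ} (hm : 2 ≤ |2 * m - 1|) (hn : n ≠ 0) {r t : F}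
    (hr : aeval r (wr (2 * m - 1)) = 0) (ht : aeval t (wr (2 * n)) = 0)
    (h : aeval r (Phi (2 * m - 1 + 1)) * aeval t (Phi (2 * n - 1)) =
      aeval r (Phi (2 * m - 1 - 1)) * aeval t (Phi (2 * n + 1))) : False := by
  obtain ⟨O, hO⟩ := exists_valuationSubring_two F
  have hrO : r ∈ O := (O.valuation_le_one_iff r).1
    (valuation_le_one_of_isIntegral _ (isIntegral_of_aeval_f hm (aeval_f_of_wr_odd hr)))
  have htO : t ∈ O := (O.valuation_le_one_iff t).1
    (valuation_le_one_of_isIntegral _ (isIntegral_of_aeval_f (j := 2 * n) (c := -(2 * n)) (by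
      rw [abs_mul, abs_two]; linarith [Int.one_le_abs hn])
      (by rw [aeval_f_of_wr_even ht]; push_cast; ring)))
  have h20 : IsLocalRing.residue O 2 = 0 :=
    (IsLocalRing.residue_eq_zero_iff _).2 ((O.valuation_lt_one_iff 2).2 hO)
  have h20' : (2 : IsLocalRing.ResidueField O) = 0 := by rwa [map_ofNat] at h20
  have hι : ∀ (x : O) (p : ℤ[X]), O.subtype (aeval x p) = aeval (x : F) p := fun x p =>
    (aeval_algHom_apply O.subtype.toIntAlgHom x p).symm
  have hρ : ∀ (x : O) (p : ℤ[X]), aeval (IsLocalRing.residue O x) p =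
      IsLocalRing.residue O (aeval x p) := fun x p =>
    aeval_algHom_apply (IsLocalRing.residue O).toIntAlgHom x p
  have hinj : Function.Injective O.subtype := Subtype.val_injective
  obtain ⟨x, rfl⟩ : ∃ x : O, (x : F) = r := ⟨⟨r, hrO⟩, rfl⟩
  obtain ⟨y, rfl⟩ : ∃ y : O, (y : F) = t := ⟨⟨t, htO⟩, rfl⟩
  have h1 : aeval x (f (2 * m - 1)) = (2 * m - 1 : ℤ) := hinj (by
    rw [hι, aeval_f_of_wr_odd hr, map_intCast])
  have h2 : aeval y (f (2 * n)) = -(2 * n : ℤ) := hinj (by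
    rw [hι, aeval_f_of_wr_even ht, map_neg, map_intCast])
  rw [← hι, ← hι, ← hι, ← hι, ← map_mul, ← map_mul] at h
  have h3 := congrArg (IsLocalRing.residue O) (hinj h)
  have h1' := congrArg (IsLocalRing.residue O) h1
  have h2' := congrArg (IsLocalRing.residue O) h2
  rw [← hρ] at h1' h2'
  rw [map_mul, map_mul, ← hρ, ← hρ, ← hρ, ← hρ] at h3
  refine false_of_residue (x := IsLocalRing.residue O x) (y := IsLocalRing.residue O y)
    (h1'.trans ?_) (h2'.trans ?_) h3
  · push_cast
    rw [map_sub, map_mul, h20, map_one]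
    linear_combination -h20'
  · push_cast
    rw [map_neg, map_mul, h20, zero_mul, neg_zero]

/-- There are no affine singular points for `k ≠ l`. -/
theorem false_of_wr [IsAlgClosed F] {k l : ℤ} (hl : Even l) (hl0 : l ≠ 0) (hkl : k ≠ l)
    (hk : 2 ≤ |k|) {r t : F} (hr : aeval r (wr k) = 0) (ht : aeval t (wr l) = 0)
    (h : aeval r (Phi (k + 1)) * aeval t (Phi (l - 1)) =
      aeval r (Phi (k - 1)) * aeval t (Phi (l + 1))) : False := by
  obtain ⟨n, rfl⟩ := even_iff_two_dvd.1 hl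
  have hn : n ≠ 0 := by omega
  rcases Int.even_or_odd k with hk' | hk'
  · obtain ⟨m, rfl⟩ := even_iff_two_dvd.1 hk'
    have hm : m ≠ 0 := by rintro rfl; simp at hk
    obtain ⟨c, h1, h2⟩ := exists_isCritical hm hn hr ht h
    obtain ⟨O, hO⟩ := exists_valuationSubring_two F
    exact h1.false_of_ne hO hm hn (fun h => hkl (by rw [h])) h2
  · obtain ⟨m, rfl⟩ : ∃ m, k = 2 * m - 1 := by
      obtain ⟨i, rfl⟩ := hk'; exact ⟨i + 1, by ring⟩
    exact false_of_odd hk hn hr ht h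

/-- For `k = l`, the affine singular points are on the diagonal. -/
theorem eq_of_wr {l : ℤ} (hl : Even l) (hl0 : l ≠ 0) {r t : F} (hr : aeval r (wr l) = 0)
    (ht : aeval t (wr l) = 0) (h : aeval r (Phi (l + 1)) * aeval t (Phi (l - 1)) =
      aeval r (Phi (l - 1)) * aeval t (Phi (l + 1))) : r = t := by
  obtain ⟨n, rfl⟩ := even_iff_two_dvd.1 hl
  have hn : n ≠ 0 := by omega
  obtain ⟨c, h1, h2⟩ := exists_isCritical hn hn hr ht h
  exact h1.eq hn h2

/-- At a double zero of `W_l`, `f_l = -l` and `f_l' = 0`, so that `derivative_f` and the norm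
equation of `f_l`, `f_{l-1}` give `(t² - 4) (l² - 1) = 0`. -/
theorem wr_separable {l : ℤ} (hl : Even l) (hl0 : l ≠ 0) {t : F} (h : aeval t (wr l) = 0) :
    aeval t (derivative (wr l)) ≠ 0 := by
  intro h'
  obtain ⟨n, rfl⟩ := even_iff_two_dvd.1 hl
  have hn : n ≠ 0 := by omega
  have h1 := congrArg (fun p => aeval t (derivative p)) (wr_two_mul n)
  simp [h, h'] at h1
  have h2 := congrArg (aeval t) (derivative_f (2 * n))
  simp [← h1, aeval_f_of_wr_even h, map_ofNat] at h2
  have h3 := aeval_f_norm (2 * n) t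
  rw [aeval_f_of_wr_even h] at h3
  push_cast at h3
  have hn' : (n : F) ≠ 0 := Int.cast_ne_zero.2 hn
  have h4 : (2 : F) * aeval t (f (2 * n - 1)) = t - t * (2 * n) := by
    refine mul_left_cancel₀ (mul_ne_zero two_ne_zero hn') ?_
    linear_combination h2
  have h5 : (t - 2) * (t + 2) * (((2 * n - 1) * (2 * n + 1) : ℤ) : F) = 0 := by
    push_cast
    linear_combination -4 * h3 +
      (4 * n * t + 2 * aeval t (f (2 * n - 1)) + t - 2 * n * t) * h4
  rcases mul_eq_zero.1 h5 with h5 | h5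
  · rcases mul_eq_zero.1 h5 with h5 | h5
    · exact ne_two_of_wr hn h (by linear_combination h5)
    · exact ne_neg_two_of_wr hn h (by linear_combination h5)
  · rw [Int.cast_eq_zero] at h5
    rcases mul_eq_zero.1 h5 with h5 | h5 <;> omega

end

/-! ### The curves `D(k, l)` -/

section

open Polynomial

/-- `Φ_{k+s}`, for `s = ±1`, as a polynomial in the coordinate of the chart `e`. For `e = 1` the
polynomial is reversed with respect to the larger of the degrees of `Φ_{k-1}` and `Φ_{k+1}`, which
is the integral part of `|k| / 2`. -/
def chartPhi (e : Fin 2) (k s : ℤ) : ℤ[X] :=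
  if e = 0 then Phi (k + s) else reflect (k.natAbs / 2) (Phi (k + s))

/-- The equation of `D(k, l)` in the chart `(e, e')`. -/
def chartEquation (e e' : Fin 2) (k l : ℤ) : PlaneRing :=
  aeval r (chartPhi e k 1) * aeval t (chartPhi e' l (-1)) -
    aeval r (chartPhi e k (-1)) * aeval t (chartPhi e' l 1)

theorem chartPhi_zero (k s : ℤ) : chartPhi 0 k s = Phi (k + s) := if_pos rfl

theorem chartPhi_one (k s : ℤ) : chartPhi 1 k s = reflect (k.natAbs / 2) (Phi (k + s)) :=
  if_neg one_ne_zero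

theorem chartEquation_zero (k l : ℤ) : chartEquation 0 0 k l = equation k l := by
  simp only [chartEquation, chartPhi_zero, equation, sub_eq_add_neg]

theorem aeval_chartEquation {B : Type} [CommRing B] [Algebra ℚ B] (e e' : Fin 2) (k l : ℤ)
    (x y : B) : MvPolynomial.aeval ![x, y] (chartEquation e e' k l) =
      aeval x (chartPhi e k 1) * aeval y (chartPhi e' l (-1)) -
        aeval x (chartPhi e k (-1)) * aeval y (chartPhi e' l 1) := by
  have h : ∀ (z : PlaneRing) (p : ℤ[X]), MvPolynomial.aeval (R := ℚ) ![x, y] (aeval z p) =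
      aeval (MvPolynomial.aeval (R := ℚ) ![x, y] z) p := fun z p =>
    (aeval_algHom_apply ((MvPolynomial.aeval (R := ℚ) ![x, y]).restrictScalars ℤ) z p).symm
  rw [chartEquation, map_sub, map_mul, map_mul, h, h, h, h]
  simp [r, t]

theorem natDegree_Phi_le {k : ℤ} (hk : 2 ≤ |k|) {s : ℤ} (hs : s = 1 ∨ s = -1) :
    (Phi (k + s)).natDegree ≤ k.natAbs / 2 := by
  rw [Int.abs_eq_natAbs] at hk
  rw [(Phi_leadingCoeff (by omega)).2]
  omega

theorem aeval_chartPhi {B : Type} [CommRing B] {e : Fin 2} {a a' : B} (h : CoordRel e a a')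
    {k : ℤ} (hk : 2 ≤ |k|) {s : ℤ} (hs : s = 1 ∨ s = -1) :
    aeval a' (chartPhi e k s) * den e a ^ (k.natAbs / 2) = aeval a (Phi (k + s)) := by
  unfold CoordRel at h
  unfold den
  split_ifs at * with he
  · subst he
    rw [h, chartPhi_zero, one_pow, mul_one]
  · obtain rfl : e = 1 := by omega
    have : Invertible a := ⟨a', by rw [mul_comm, h], h⟩
    have h1 := eval₂_reflect_mul_pow (algebraMap ℤ B) a (k.natAbs / 2) (Phi (k + s))
      (natDegree_Phi_le hk hs)
    rw [invOf_eq_right_inv h] at h1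
    rw [chartPhi_one]
    exact h1

theorem associated_chartEquation {B : Type} [CommRing B] [Algebra ℚ B] {e e' : Fin 2} {k l : ℤ}
    (hk : 2 ≤ |k|) (hl : 2 ≤ |l|) {a b a' b' : B} (ha : CoordRel e a a') (hb : CoordRel e' b b') :
    Associated (MvPolynomial.aeval ![a', b'] (chartEquation e e' k l))
      (MvPolynomial.aeval ![a, b] (chartEquation 0 0 k l)) := by
  have hu : IsUnit (den e a ^ (k.natAbs / 2) * den e' b ^ (l.natAbs / 2)) :=
    (ha.isUnit_den.pow _).mul (hb.isUnit_den.pow _)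
  refine (associated_mul_unit_right _ _ hu).trans (Associated.of_eq ?_)
  simp only [aeval_chartEquation, chartPhi_zero]
  rw [← aeval_chartPhi ha hk (.inl rfl), ← aeval_chartPhi ha hk (.inr rfl),
    ← aeval_chartPhi hb hl (.inl rfl), ← aeval_chartPhi hb hl (.inr rfl)]
  ring

theorem aeval_zero_reflect {B : Type} [CommRing B] (N : ℕ) (p : ℤ[X]) :
    aeval (0 : B) (reflect N p) = (p.coeff N : B) := by
  rw [← coeff_zero_eq_aeval_zero', coeff_reflect, revAt_zero, eq_intCast]

theorem aeval_zero_derivative_reflect {B : Type} [CommRing B] {N : ℕ} (hN : 1 ≤ N) (p : ℤ[X]) :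
    aeval (0 : B) (derivative (reflect N p)) = (p.coeff (N - 1) : B) := by
  rw [← coeff_zero_eq_aeval_zero', coeff_derivative, coeff_reflect, revAt_le hN, eq_intCast]
  simp

/-- The degrees of `Φ_{k+1}` and `Φ_{k-1}` differ by one, and the leading coefficients are units. -/
theorem Phi_coeff {k : ℤ} (hk : 2 ≤ |k|) : ∃ s : ℤ, (s = 1 ∨ s = -1) ∧
    IsUnit ((Phi (k + s)).coeff (k.natAbs / 2)) ∧ (Phi (k + -s)).coeff (k.natAbs / 2) = 0 ∧
      IsUnit ((Phi (k + -s)).coeff (k.natAbs / 2 - 1)) := by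
  rw [Int.abs_eq_natAbs] at hk
  have key : ∀ s : ℤ, (s = 1 ∨ s = -1) → k.natAbs + 1 = (k + s).natAbs →
      IsUnit ((Phi (k + s)).coeff (k.natAbs / 2)) ∧ (Phi (k + -s)).coeff (k.natAbs / 2) = 0 ∧
      IsUnit ((Phi (k + -s)).coeff (k.natAbs / 2 - 1)) := by
    intro s hs h
    have h1 := Phi_leadingCoeff (k := k + s) (by omega)
    have h2 := Phi_leadingCoeff (k := k + -s) (by omega)
    refine ⟨?_, ?_, ?_⟩
    · have := h1.1
      rwa [leadingCoeff, h1.2, ← h, Nat.add_sub_cancel] at this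
    · refine coeff_eq_zero_of_natDegree_lt ?_
      rw [h2.2]; omega
    · have := h2.1
      rwa [leadingCoeff, h2.2, show ((k + -s).natAbs - 1) / 2 = k.natAbs / 2 - 1 by omega] at this
  rcases le_total 0 k with h | h
  · exact ⟨1, .inl rfl, key 1 (.inl rfl) (by omega)⟩
  · exact ⟨-1, .inr rfl, key (-1) (.inr rfl) (by omega)⟩

theorem intCast_ne_zero_of_isUnit {z : ℤ} (h : IsUnit z) : (z : K) ≠ 0 :=
  Int.cast_ne_zero.2 h.ne_zero

/-- Exactly one of the two functions vanishes at infinity. -/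
theorem chartPhi_one_aeval_zero {k : ℤ} (hk : 2 ≤ |k|) :
    (aeval (0 : K) (chartPhi 1 k 1) ≠ 0 ∧ aeval (0 : K) (chartPhi 1 k (-1)) = 0) ∨
      (aeval (0 : K) (chartPhi 1 k 1) = 0 ∧ aeval (0 : K) (chartPhi 1 k (-1)) ≠ 0) := by
  simp only [chartPhi_one, aeval_zero_reflect]
  obtain ⟨s, rfl | rfl, h1, h2, -⟩ := Phi_coeff hk
  · exact .inl ⟨intCast_ne_zero_of_isUnit h1, by rw [h2, Int.cast_zero]⟩
  · rw [neg_neg] at h2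
    exact .inr ⟨by rw [h2, Int.cast_zero], intCast_ne_zero_of_isUnit h1⟩

/-- The point at infinity is not critical. -/
theorem wronskian_chartPhi_ne_zero {k : ℤ} (hk : 2 ≤ |k|) :
    aeval (0 : K) (wronskian (chartPhi 1 k (-1)) (chartPhi 1 k 1)) ≠ 0 := by
  have hN : 1 ≤ k.natAbs / 2 := by rw [Int.abs_eq_natAbs] at hk; omega
  simp only [wronskian, chartPhi_one, map_sub, map_mul, aeval_zero_reflect,
    aeval_zero_derivative_reflect hN]
  obtain ⟨s, rfl | rfl, h1, h2, h3⟩ := Phi_coeff hk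
  · rw [h2, Int.cast_zero, zero_mul, zero_sub]
    exact neg_ne_zero.2 (mul_ne_zero (intCast_ne_zero_of_isUnit h3) (intCast_ne_zero_of_isUnit h1))
  · rw [neg_neg] at h2 h3
    rw [h2, Int.cast_zero, mul_zero, sub_zero]
    exact mul_ne_zero (intCast_ne_zero_of_isUnit h1) (intCast_ne_zero_of_isUnit h3)

theorem chartPhi_pair_ne_zero {k : ℤ} (hk : 2 ≤ |k|) (e : Fin 2) (a : K) :
    ¬ (aeval a (chartPhi e k 1) = 0 ∧ aeval a (chartPhi e k (-1)) = 0) := by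
  rintro ⟨h1, h2⟩
  rcases exists_coordRel_symm e a with ⟨rfl, rfl⟩ | ⟨a', h⟩
  · rcases chartPhi_one_aeval_zero hk with h | h
    · exact h.1 h1
    · exact h.2 h2
  · have h3 := aeval_chartPhi h hk (.inl rfl)
    have h4 := aeval_chartPhi h hk (.inr rfl)
    rw [h1, zero_mul] at h3
    rw [h2, zero_mul] at h4
    exact Phi_pair_ne_zero k a' ⟨h4.symm, h3.symm⟩

theorem aeval_tang_poly (a α : K) (p : ℤ[X]) :
    @aeval ℤ (DualNumber K) _ _ (Ring.toIntAlgebra _) (tang a α) p =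
      tang (aeval a p) (α * aeval a (derivative p)) := by
  have hi : ∀ q : ℤ[X], @aeval ℤ (DualNumber K) _ _ (Ring.toIntAlgebra _)
      (TrivSqZeroExt.inl a) q = TrivSqZeroExt.inl (aeval a q) := fun q =>
    aeval_algHom_apply (TrivSqZeroExt.inlHom K K).toIntAlgHom a q
  rw [tang, aeval_add_of_sq_eq_zero _ _ _ (by rw [sq, TrivSqZeroExt.inr_mul_inr]), hi, hi, tang,
    TrivSqZeroExt.inl_mul_inr, smul_eq_mul, mul_comm]

/-- The conditions on a singular point `(a, b)` are linear equations for the values at `b` of two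
functions without common zero, so their determinant, the Wronskian at `a`, vanishes; and vice
versa. -/
theorem IsSing.wronskian_eq_zero {e e' : Fin 2} {k l : ℤ} (hk : 2 ≤ |k|) (hl : 2 ≤ |l|) {a b : K}
    (h : IsSing (chartEquation e e' k l) a b) :
    aeval a (wronskian (chartPhi e k (-1)) (chartPhi e k 1)) = 0 ∧
      aeval b (wronskian (chartPhi e' l (-1)) (chartPhi e' l 1)) = 0 ∧
        aeval a (chartPhi e k 1) * aeval b (chartPhi e' l (-1)) =
          aeval a (chartPhi e k (-1)) * aeval b (chartPhi e' l 1) := by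
  have h1 := h 1 0
  have h2 := h 0 1
  simp only [aeval_chartEquation, aeval_tang_poly, zero_mul, one_mul] at h1 h2
  have e0 := congrArg TrivSqZeroExt.fst h1
  have e1 := congrArg TrivSqZeroExt.snd h1
  have e2 := congrArg TrivSqZeroExt.snd h2
  simp [tang] at e0 e1 e2
  have hp := chartPhi_pair_ne_zero hk e a
  have hq := chartPhi_pair_ne_zero hl e' b
  simp only [wronskian, map_sub, map_mul]
  refine ⟨?_, ?_, sub_eq_zero.1 e0⟩
  · by_contra hne
    refine hq ⟨?_, ?_⟩
    · refine (mul_eq_zero.1 ?_).resolve_left hne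
      linear_combination (-(aeval a (derivative (chartPhi e k 1)))) * e0 +
        aeval a (chartPhi e k 1) * e1
    · refine (mul_eq_zero.1 ?_).resolve_left hne
      linear_combination (-(aeval a (derivative (chartPhi e k (-1))))) * e0 +
        aeval a (chartPhi e k (-1)) * e1
  · by_contra hne
    refine hp ⟨?_, ?_⟩
    · refine (mul_eq_zero.1 ?_).resolve_left hne
      linear_combination aeval b (derivative (chartPhi e' l 1)) * e0 -
        aeval b (chartPhi e' l 1) * e2
    · refine (mul_eq_zero.1 ?_).resolve_left hne
      linear_combination aeval b (derivative (chartPhi e' l (-1))) * e0 -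
        aeval b (chartPhi e' l (-1)) * e2

theorem eq_zero_of_aeval {p : ℤ[X]} (h : ∀ b : K, aeval b p = 0) : p = 0 := by
  have h1 : p.map (algebraMap ℤ K) = 0 := Polynomial.funext fun b => by
    rw [eval_map_algebraMap, h, eval_zero]
  exact (Polynomial.map_eq_zero_iff (FaithfulSMul.algebraMap_injective ℤ K)).1 h1

theorem chartPhi_ne_zero (e : Fin 2) {k s : ℤ} (h : k + s ≠ 0) : chartPhi e k s ≠ 0 := by
  have : Phi (k + s) ≠ 0 := fun h0 => by
    have := (Phi_leadingCoeff h).1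
    rw [h0, leadingCoeff_zero] at this
    exact this.ne_zero rfl
  unfold chartPhi
  split_ifs
  · exact this
  · rwa [Ne, reflect_eq_zero_iff]

theorem not_r_dvd_chartEquation (e' : Fin 2) {k l : ℤ} (hk : 2 ≤ |k|) (hl : 2 ≤ |l|) :
    ¬ r ∣ chartEquation 1 e' k l := by
  rintro ⟨q, hq⟩
  rw [Int.abs_eq_natAbs] at hl
  have h : ∀ b : K, aeval (0 : K) (chartPhi 1 k 1) * aeval b (chartPhi e' l (-1)) -
      aeval (0 : K) (chartPhi 1 k (-1)) * aeval b (chartPhi e' l 1) = 0 := fun b => by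
    rw [← aeval_chartEquation, hq]
    simp [r]
  rcases chartPhi_one_aeval_zero hk with ⟨h1, h2⟩ | ⟨h1, h2⟩
  · refine chartPhi_ne_zero e' (k := l) (s := -1) (by omega) (eq_zero_of_aeval fun b => ?_)
    simpa [h1, h2] using h b
  · refine chartPhi_ne_zero e' (k := l) (s := 1) (by omega) (eq_zero_of_aeval fun b => ?_)
    simpa [h1, h2] using h b

theorem not_t_dvd_chartEquation (e : Fin 2) {k l : ℤ} (hk : 2 ≤ |k|) (hl : 2 ≤ |l|) :
    ¬ t ∣ chartEquation e 1 k l := by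
  rintro ⟨q, hq⟩
  rw [Int.abs_eq_natAbs] at hk
  have h : ∀ a : K, aeval a (chartPhi e k 1) * aeval (0 : K) (chartPhi 1 l (-1)) -
      aeval a (chartPhi e k (-1)) * aeval (0 : K) (chartPhi 1 l 1) = 0 := fun a => by
    rw [← aeval_chartEquation, hq]
    simp [t]
  rcases chartPhi_one_aeval_zero hl with ⟨h1, h2⟩ | ⟨h1, h2⟩
  · refine chartPhi_ne_zero e (k := k) (s := -1) (by omega) (eq_zero_of_aeval fun b => ?_)
    simpa [h1, h2] using h b
  · refine chartPhi_ne_zero e (k := k) (s := 1) (by omega) (eq_zero_of_aeval fun b => ?_)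
    simpa [h1, h2] using h b

theorem IsSing.wr_eq_zero {k l : ℤ} (hk : 2 ≤ |k|) (hl : 2 ≤ |l|) {a b : K}
    (h : IsSing (chartEquation 0 0 k l) a b) : aeval a (wr k) = 0 ∧ aeval b (wr l) = 0 ∧
      aeval a (Phi (k + 1)) * aeval b (Phi (l - 1)) =
        aeval a (Phi (k - 1)) * aeval b (Phi (l + 1)) := by
  have := h.wronskian_eq_zero hk hl
  simpa only [wr, chartPhi_zero, ← sub_eq_add_neg] using this

theorem smooth_D {k l : ℤ} (hl : Even l) (hl2 : 2 ≤ |l|) (hkl : k ≠ l) (hk : 2 ≤ |k|) :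
    SmoothOfRelativeDimension 1 (D.toSpec k l) := by
  have h := smooth_closure_of_not_isSing (fun e e' => chartEquation e e' k l)
    (fun e e' B _ _ _ a b a' b' _ ha hb => associated_chartEquation hk hl2 ha hb)
    (fun e' => not_r_dvd_chartEquation e' hk hl2) (fun e => not_t_dvd_chartEquation e hk hl2)
    (fun a b hs => ?_)
    (fun e' b hs => wronskian_chartPhi_ne_zero hk (hs.wronskian_eq_zero hk hl2).1)
    (fun e a hs => wronskian_chartPhi_ne_zero hl2 (hs.wronskian_eq_zero hk hl2).2.1)
  · beta_reduce at h
    rw [chartEquation_zero] at h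
    exact h
  · obtain ⟨h1, h2, h3⟩ := hs.wr_eq_zero hk hl2
    exact false_of_wr hl (by rintro rfl; simp at hl2) hkl hk h1 h2 h3

end

/-! ### The residual curves `D₁(l, l)` -/

section

open Polynomial

/-- The equation of the closure of the line `r = t` in the chart `(e, e')`. -/
def chartLine (e e' : Fin 2) : PlaneRing := if e = e' then t - r else r * t - 1

theorem chartLine_zero : chartLine 0 0 = t - r := if_pos rfl

theorem associated_chartLine {B : Type} [CommRing B] [Algebra ℚ B] {e e' : Fin 2} {a b a' b' : B}
    (ha : CoordRel e a a') (hb : CoordRel e' b b') :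
    Associated (MvPolynomial.aeval ![a', b'] (chartLine e e'))
      (MvPolynomial.aeval ![a, b] (chartLine 0 0)) := by
  have hr : ∀ x y : B, MvPolynomial.aeval (R := ℚ) ![x, y] r = x := by simp [r]
  have ht : ∀ x y : B, MvPolynomial.aeval (R := ℚ) ![x, y] t = y := by simp [t]
  have h00 : MvPolynomial.aeval (R := ℚ) ![a, b] (chartLine 0 0) = b - a := by
    rw [chartLine_zero, map_sub, hr, ht]
  have hu := ha.isUnit_den.mul hb.isUnit_den
  rw [h00]
  have h01 : Associated (a - b) (b - a) := by
    rw [← neg_sub b a]; exact (Associated.refl _).neg_left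
  unfold CoordRel den at *
  fin_cases e <;> fin_cases e'
  · obtain rfl : a' = a := ha
    obtain rfl : b' = b := hb
    rw [← h00]
    exact Associated.refl _
  · obtain rfl : a' = a := ha
    have hb : b * b' = 1 := hb
    refine (associated_mul_unit_right _ _ hu).trans ((Associated.of_eq ?_).trans h01)
    simp [chartLine, hr, ht]
    linear_combination a' * hb
  · obtain rfl : b' = b := hb
    have ha : a * a' = 1 := ha
    refine (associated_mul_unit_right _ _ hu).trans (Associated.of_eq ?_)
    simp [chartLine, hr, ht]
    linear_combination b' * ha
  · have ha : a * a' = 1 := ha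
    have hb : b * b' = 1 := hb
    refine (associated_mul_unit_right _ _ hu).trans ((Associated.of_eq ?_).trans h01)
    simp [chartLine, hr, ht]
    linear_combination a * hb - b * ha

/-- The closure of the line `r = t` is contained in `D(l, l)`. -/
theorem chartLine_dvd {l : ℤ} (hl : 2 ≤ |l|) (e e' : Fin 2) :
    chartLine e e' ∣ chartEquation e e' l l := by
  by_cases h : e = e'
  · subst h
    rw [chartLine, if_pos rfl, chartEquation]
    have hp : t - r ∣ aeval t (chartPhi e l 1) - aeval r (chartPhi e l 1) := sub_dvd_aeval_sub t r _
    have hq : t - r ∣ aeval t (chartPhi e l (-1)) - aeval r (chartPhi e l (-1)) :=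
      sub_dvd_aeval_sub t r _
    obtain ⟨p, hp⟩ := hp
    obtain ⟨q, hq⟩ := hq
    refine ⟨q * aeval t (chartPhi e l 1) - p * aeval t (chartPhi e l (-1)), ?_⟩
    linear_combination aeval t (chartPhi e l 1) * hq - aeval t (chartPhi e l (-1)) * hp
  · rw [chartLine, if_neg h]
    let I : Ideal PlaneRing := Ideal.span {r * t - 1}
    have hrt : Ideal.Quotient.mkₐ ℚ I r * Ideal.Quotient.mkₐ ℚ I t = 1 := by
      rw [← map_mul, ← sub_eq_zero, ← map_one (Ideal.Quotient.mkₐ ℚ I), ← map_sub]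
      exact Ideal.Quotient.eq_zero_iff_mem.2 (Ideal.mem_span_singleton_self _)
    have h0 : Ideal.Quotient.mkₐ ℚ I (chartEquation e e' l l) = 0 := by
      rw [aeval_coords (Ideal.Quotient.mkₐ ℚ I), aeval_chartEquation]
      have hcase : (e = 0 ∧ e' = 1) ∨ (e = 1 ∧ e' = 0) := by omega
      rcases hcase with ⟨rfl, rfl⟩ | ⟨rfl, rfl⟩
      · have hc : CoordRel 1 (Ideal.Quotient.mkₐ ℚ I r) (Ideal.Quotient.mkₐ ℚ I t) := hrt
        rw [chartPhi_zero, chartPhi_zero, ← aeval_chartPhi hc hl (.inl rfl),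
          ← aeval_chartPhi hc hl (.inr rfl)]
        ring
      · have hc : CoordRel 1 (Ideal.Quotient.mkₐ ℚ I t) (Ideal.Quotient.mkₐ ℚ I r) := by
          rw [mul_comm] at hrt; exact hrt
        rw [chartPhi_zero, chartPhi_zero, ← aeval_chartPhi hc hl (.inl rfl),
          ← aeval_chartPhi hc hl (.inr rfl)]
        ring
    exact Ideal.mem_span_singleton.1 (Ideal.Quotient.eq_zero_iff_mem.1 h0)

/-- Multiplied by `t - r`, the equation `G` of the residual curve vanishes to order three along the
line `t = a` at a diagonal singular point, and its second derivative there is that of the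
Wronskian. -/
theorem IsSing.aeval_derivative_wr {l : ℤ} {G : PlaneRing} (hG : equation l l = (t - r) * G)
    {a : K} (h : IsSing G a a) : aeval a (derivative (wr l)) = 0 := by
  let S : PlaneRing →ₐ[ℚ] K[X] := MvPolynomial.aeval ![X, C a]
  set p := S G
  have hS : ∀ (z : PlaneRing) (q : ℤ[X]), S (aeval z q) = aeval (S z) q := fun z q =>
    (aeval_algHom_apply S.toRingHom.toIntAlgHom z q).symm
  have hC : ∀ q : ℤ[X], aeval (C a) q = C (aeval a q) := fun q =>
    aeval_algHom_apply (C : K →+* K[X]).toIntAlgHom a q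
  have hX : ∀ q : ℤ[X], aeval (X : K[X]) q = q.map (algebraMap ℤ K) := fun q => by
    rw [aeval_X_left_eq_map]
  have hp : ∀ α : K, aeval (tang a α) p = 0 := fun α => by
    have e : ((aeval (R := K) (tang a α)).restrictScalars ℚ).comp S =
        MvPolynomial.aeval ![tang a α, tang a 0] := by
      ext i
      · fin_cases i <;> simp [S, tang, TrivSqZeroExt.algebraMap_eq_inl]
      · fin_cases i <;> simp [S, tang, TrivSqZeroExt.algebraMap_eq_inl]
    exact (DFunLike.congr_fun e G).trans (h α 0)
  have hi : ∀ q : K[X], aeval (TrivSqZeroExt.inl a : DualNumber K) q =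
      TrivSqZeroExt.inl (q.eval a) := fun q => by
    rw [← TrivSqZeroExt.algebraMap_eq_inl, aeval_algebraMap_apply, coe_aeval_eq_eval,
      TrivSqZeroExt.algebraMap_eq_inl]
  have hp' : tang (p.eval a) ((derivative p).eval a) = 0 := by
    have := hp 1
    rw [tang, aeval_add_of_sq_eq_zero _ _ _ (by rw [sq, TrivSqZeroExt.inr_mul_inr]), hi, hi,
      TrivSqZeroExt.inl_mul_inr, smul_eq_mul, mul_one] at this
    exact this
  have hp0 : p.eval a = 0 := by simpa [tang] using congrArg TrivSqZeroExt.fst hp'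
  have hp1 : (derivative p).eval a = 0 := by simpa [tang] using congrArg TrivSqZeroExt.snd hp'
  have hF := congrArg S hG
  rw [equation, map_sub, map_mul, map_mul, map_mul, hS, hS, hS, hS, map_sub] at hF
  have hSr : S r = X := by simp [S, r]
  have hSt : S t = C a := by simp [S, t]
  rw [hSr, hSt, hC, hC, hX, hX] at hF
  have h2 := congrArg (fun q => (derivative (derivative q)).eval a) hF
  have hev : ∀ q : ℤ[X], (q.map (Int.castRingHom K)).eval a = aeval a q := fun q =>
    eval_map_algebraMap q a
  simp only [derivative_sub, derivative_add, derivative_mul, derivative_C, derivative_X,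
    derivative_one, derivative_zero, derivative_map, eval_sub, eval_add, eval_mul, eval_C, eval_X,
    eval_one, eval_zero, algebraMap_int_eq, hev, show S G = p from rfl, hp0, hp1] at h2
  rw [wr, wronskian]
  simp only [derivative_mul, map_sub, map_add, map_mul]
  linear_combination h2

theorem smooth_D₁ {l : ℤ} (hl : Even l) (hl2 : 2 ≤ |l|) :
    SmoothOfRelativeDimension 1 (D₁.toSpec l) := by
  choose G hG using chartLine_dvd hl2
  have h0 : equation l l = (t - r) * G 0 0 := by
    rw [← chartLine_zero, ← hG, chartEquation_zero]
  have hI : idealD₁ l = Ideal.span {G 0 0} := by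
    have hne : (t - r : PlaneRing) ≠ 0 := by
      intro h
      have := congrArg (MvPolynomial.eval ![0, 1]) h
      simp [r, t] at this
    ext x
    rw [idealD₁, Submodule.mem_colon_singleton, idealD, h0, smul_eq_mul, Ideal.mem_span_singleton,
      Ideal.mem_span_singleton, mul_comm x, mul_dvd_mul_iff_left hne]
  have hl0 : l ≠ 0 := by rintro rfl; simp at hl2
  have hs : ∀ {e e' : Fin 2} {a b : K}, IsSing (G e e') a b → IsSing (chartEquation e e' l l) a b :=
    fun h => by rw [hG]; exact h.mul _
  suffices SmoothOfRelativeDimension 1 (closure.toSpec (Ideal.span {G 0 0})) by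
    rw [← hI] at this
    exact this
  refine smooth_closure_of_not_isSing G (fun e e' B _ _ _ a b a' b' hab ha hb => ?_)
    (fun e' h => not_r_dvd_chartEquation e' hl2 hl2 (by rw [hG]; exact h.mul_left _))
    (fun e h => not_t_dvd_chartEquation e hl2 hl2 (by rw [hG]; exact h.mul_left _))
    (fun a b h => ?_)
    (fun e' b h => wronskian_chartPhi_ne_zero hl2 ((hs h).wronskian_eq_zero hl2 hl2).1)
    (fun e a h => wronskian_chartPhi_ne_zero hl2 ((hs h).wronskian_eq_zero hl2 hl2).2.1)
  · have h1 := associated_chartEquation hl2 hl2 ha hb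
    rw [hG, hG, map_mul, map_mul] at h1
    refine h1.of_mul_left (associated_chartLine ha hb) ?_
    rw [Ne, (associated_chartLine ha hb).eq_zero_iff, chartLine_zero]
    simpa [r, t, sub_eq_zero] using hab.symm
  · obtain ⟨h1, h2, h3⟩ := (hs h).wr_eq_zero hl2 hl2
    obtain rfl := eq_of_wr hl hl0 h1 h2 h3
    exact wr_separable hl hl0 h1 (h.aeval_derivative_wr h0)

end

end DoubleTwist

end

theorem theorem5p1 (l : ℤ) (hl : Even l) (hl2 : 2 ≤ |l|) :
    (∀ k : ℤ, k ≠ l → 2 ≤ |k| →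
      AlgebraicGeometry.SmoothOfRelativeDimension 1 (DoubleTwist.D.toSpec k l)) ∧
    (2 < |l| → AlgebraicGeometry.SmoothOfRelativeDimension 1 (DoubleTwist.D₁.toSpec l)) :=
  ⟨fun _ hkl hk => DoubleTwist.smooth_D hl hl2 hkl hk, fun _ => DoubleTwist.smooth_D₁ hl hl2⟩
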